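/- **Setting.** For real random variables $(U_a)_{a\in A}$, $A$ finite and nonempty, with moments of all orders, the joint cumulant is $$\mathbf C\{U_a\}_{a\in A}=\sum_{\pi}(-1)^{\#\pi-1}(\#\pi-1)!\prod_{D\in\pi}\mathbf E\prod_{a\in D}U_a ,$$ the sum being over all set partitions $\pi$ of $A$. Let $\{Z_j\}_{j\in\mathbb Z}$ be a (strictly) stationary sequence of real random variables such that $\mathbf E|Z_0|^k<\infty$ for all $k\ge1$, $\mathbf E Z_0=0$, and $\sum_{j_1,\dots,j_r\in\mathbb Z}|\mathbf C(Z_0,Z_{j_1},\dots,Z_{j_r})|<\infty$ for all $r\ge1$. For every integer $p\ge1$ let $b=b(p)>0$ be a real number and $n=n(p)$ a positive integer, with $b\le p$ and, as $p\to\infty$, $b\to\infty$, $n\to\infty$, $b/n\to0$. Let $\{Z^{(i)}_j\}_{j\in\mathbb Z}$, $i=1,2,\dots$, be i.i.d. copies of the sequence $\{Z_j\}_{j\in\mathbb Z}$, and let $Y=Y^{(p)}$ be the random $p\times p$ matrix $$Y_{ij}=B_{ij}(X^TX)_{ij},\qquad X_{ij}=Z^{(i)}_j/\sqrt n\quad(1\le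 i\le n,\ 1\le j\le p),\qquad B_{ij}=\begin{cases}1,&|i-j|\le b,\\0,&|i-j|>b.\end{cases}$$ Put $R(j)=\operatorname{Cov}(Z_0,Z_j)$, let $R^{(0)}_i=\delta_{i0}$ and $R^{(m+1)}_i=\sum_{l\in\mathbb Z}R^{(m)}_{i-l}R(l)$ (so $R^{(m)}$ is the $m$-fold convolution power of $R$), and let $f_Z(\theta)=\sum_{j\in\mathbb Z}e^{2\pi i j\theta}R(j)$ be the spectral density. For an integer $k>0$ consider set partitions of $\{1,\dots,2k\}$, and let $$\Pi_0=\{\{1,2\},\{3,4\},\dots,\{2k-1,2k\}\},\qquad \Pi_1=\{\{2,3\},\{4,5\},\dots,\{2k,1\}\}.$$ Let $\mathrm{Part}_2(2k)$ be the set of partitions all of whose parts have at least two elements, and let $\#\Pi\vee\Pi'$ be the number of parts of the finest partition that both $\Pi$ and $\Pi'$ refine. For $\Pi\in\mathrm{Part}_2(2k)$ put $$c_p(\Pi)=p^{-1}\,n^{-k+\#\Pi_0\vee\Pi}\sum_{\mathbf j}\ \prod_{t=1}^{k}B_{\mathbf j(2t-1)\,\mathbf j(2t)}\ \prod_{A\in\Pi}\mathbf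 C\{Z_{\mathbf j(\alpha)}\}_{\alpha\in A},$$ where $\mathbf j$ runs over the functions $\{1,\dots,2k\}\to\{1,\dots,p\}$ that are constant on each part of $\Pi_1$. **Proposition 7.1.** The function $R$ is summable, the series defining $R^{(m)}_i$ and $f_Z(\theta)$ converge absolutely, and $f_Z$ is real valued. For every integer $k>0$, $\operatorname{trace}Y^k$ is integrable for every $p$, $f_Z^k$ is integrable on $[0,1]$, and $$\lim_{p\to\infty}p^{-1}\,\mathbf E\operatorname{trace}Y^k=R^{(k)}_0=\int_0^1 f_Z(\theta)^k\,d\theta .$$ Moreover only the partition $\Pi_0$ contributes in the limit: for every $p\ge1$, $$p^{-1}\,\mathbf E\operatorname{trace}Y^k=\sum_{\Pi\in\mathrm{Part}_2(2k)}c_p(\Pi),$$ and, as $p\to\infty$, $c_p(\Pi_0)\to R^{(k)}_0$, while $c_p(\Pi)\to0$ for every $\Pi\in\mathrm{Part}_2(2k)$ with $\Pi\ne\Pi_0$. -/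

import Mathlib

open MeasureTheory ProbabilityTheory Filter Topology

namespace BandedCov

noncomputable section

/-! ## Joint cumulants and stationary sequences -/

/-- The joint cumulant `C {X i}_{i ∈ s}` of real random variables on `(Ω, μ)`: the sum over all set
partitions `π` of `s` of `(-1)^(#π - 1) (#π - 1)! ∏_{A ∈ π} E ∏_{i ∈ A} X i`.
(The value for empty `s` is never used.) -/
def jointCumulant {Ω ι : Type*} [MeasurableSpace Ω] [DecidableEq ι] (μ : Measure Ω)
    (X : ι → Ω → ℝ) (s : Finset ι) : ℝ :=
  ∑ π : Finpartition s, (-1 : ℝ) ^ (π.parts.card - 1) * ((π.parts.card - 1).factorial : ℝ) *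
    ∏ A ∈ π.parts, ∫ ω, ∏ i ∈ A, X i ω ∂μ

/-- `Z` is a (strictly) stationary sequence of real random variables: the joint law of the whole
sequence is invariant under every shift of the index. -/
structure IsStationary {Ω : Type*} [MeasurableSpace Ω] (μ : Measure Ω) (Z : ℤ → Ω → ℝ) :
    Prop where
  measurable : ∀ j, Measurable (Z j)
  map_shift : ∀ m : ℤ, μ.map (fun ω (j : ℤ) => Z (j + m) ω) = μ.map (fun ω (j : ℤ) => Z j ω)

/-- Finite moments of every order, mean zero, and joint cumulant summability
`∑_{j₁} ⋯ ∑_{jᵣ} |C(Z_0, Z_{j₁}, …, Z_{jᵣ})| < ∞` for all `r ≥ 1`. -/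
structure CumulantSummable {Ω : Type*} [MeasurableSpace Ω] (μ : Measure Ω) (Z : ℤ → Ω → ℝ) :
    Prop where
  moments : ∀ k : ℕ, 1 ≤ k → Integrable (fun ω => |Z 0 ω| ^ k) μ
  mean_zero : ∫ ω, Z 0 ω ∂μ = 0
  summable : ∀ r : ℕ, 1 ≤ r → Summable fun j : Fin r → ℤ =>
    |jointCumulant μ (fun i : Fin (r + 1) => Z ((Fin.cons 0 j : Fin (r + 1) → ℤ) i)) Finset.univ|

/-- The asymptotic regime: `b = b(p) > 0` real, `n = n(p)` a positive integer, `b ≤ p`, and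
`b → ∞`, `n → ∞`, `b / n → 0` as `p → ∞`. -/
structure BandRegime (b : ℕ → ℝ) (n : ℕ → ℕ) : Prop where
  b_pos : ∀ p, 1 ≤ p → 0 < b p
  n_pos : ∀ p, 1 ≤ p → 0 < n p
  b_le : ∀ p, 1 ≤ p → b p ≤ p
  b_tendsto : Tendsto b atTop atTop
  n_tendsto : Tendsto n atTop atTop
  ratio_tendsto : Tendsto (fun p => b p / (n p : ℝ)) atTop (𝓝 0)

/-! ## The random matrices -/

/-- The `n × p` data matrix `X i j = Z_j^{(i)} / √n` at the sample point `ω`. The columns are the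
times `1, …, p`; the i.i.d. rows are the copies `W 0, …, W (n - 1)`. -/
def dataMatrix {Ω : Type*} (W : ℕ → ℤ → Ω → ℝ) (n p : ℕ) (ω : Ω) : Matrix (Fin n) (Fin p) ℝ :=
  Matrix.of fun i j => W i ((j : ℤ) + 1) ω / √(n : ℝ)

/-- The banding matrix with entries `1` if `|i - j| ≤ b` and `0` otherwise. -/
def bandMatrix (b : ℝ) (p : ℕ) : Matrix (Fin p) (Fin p) ℝ := by
  classical exact Matrix.of fun i j => if |(i : ℝ) - (j : ℝ)| ≤ b then 1 else 0

/-- The banded empirical covariance matrix `Y i j = B i j * (Xᵀ X) i j`. -/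
def bandedCov {Ω : Type*} (W : ℕ → ℤ → Ω → ℝ) (b : ℝ) (n p : ℕ) (ω : Ω) :
    Matrix (Fin p) (Fin p) ℝ :=
  Matrix.of fun i j =>
    bandMatrix b p i j * ((dataMatrix W n p ω).transpose * dataMatrix W n p ω) i j

/-! ## Covariances, convolution powers, spectral density -/

/-- `R(j) = Cov(Z_0, Z_j)`. -/
def autocov {Ω : Type*} [MeasurableSpace Ω] (μ : Measure Ω) (Z : ℤ → Ω → ℝ) (j : ℤ) : ℝ :=
  covariance (Z 0) (Z j) μ

/-- Convolution powers on `ℤ`: `R^{(0)} = δ_0` and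
`R^{(m+1)}(i) = (R^{(m)} ⋆ R)(i) = ∑_l R^{(m)}(i - l) R(l)`. -/
def convPow (R : ℤ → ℝ) : ℕ → ℤ → ℝ
  | 0 => fun i => if i = 0 then 1 else 0
  | m + 1 => fun i => ∑' l : ℤ, convPow R m (i - l) * R l

/-- The spectral density `f(θ) = ∑_j e^{2π i j θ} R(j)`, as a real number. -/
def specDensity (R : ℤ → ℝ) (θ : ℝ) : ℝ :=
  (∑' j : ℤ, Complex.exp (2 * Real.pi * Complex.I * j * θ) * (R j : ℂ)).re

/-! ## Set partitions and the contribution of a partition -/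

/-- The `2k` positions of a word: `(t, false)` is position `2t - 1` and `(t, true)` is position
`2t` (for `t` counted from `1`). -/
abbrev Pos (k : ℕ) := Fin k × Bool

/-- Set partitions of the `2k` positions. -/
abbrev Part (k : ℕ) := Finpartition (Finset.univ : Finset (Pos k))

/-- The perfect matching `Π₀ = {1,2}, {3,4}, …, {2k-1,2k}`. -/
def matching0 (k : ℕ) : Part k := by
  classical exact Finpartition.ofSetoid (Setoid.ker (Prod.fst : Pos k → Fin k))

/-- The perfect matching `Π₁ = {2,3}, {4,5}, …, {2k,1}`: position `(t, true)` is matched with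
`(t + 1, false)`, cyclically in `t`. -/
def matching1 (k : ℕ) : Part k := by
  classical
  exact Finpartition.ofSetoid
    (Setoid.ker fun a : Pos k => if a.2 = true then finRotate k a.1 else a.1)

/-- The partitions all of whose parts have at least two elements. -/
def part2 (k : ℕ) : Finset (Part k) := by
  classical exact Finset.univ.filter fun P : Part k => ∀ A ∈ P.parts, 2 ≤ A.card

/-- `#(P ∨ Q)`: the number of parts of the finest partition refined by both partitions. -/
def cardJoin {k : ℕ} (P Q : Part k) : ℕ :=
  Nat.card (Quotient (Setoid.ker P.part ⊔ Setoid.ker Q.part))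

/-- A function on the positions is `P`-measurable if it is constant on each part of `P`. -/
def IsMeas {k : ℕ} {α : Type*} (P : Part k) (j : Pos k → α) : Prop :=
  ∀ A ∈ P.parts, ∀ a ∈ A, ∀ a' ∈ A, j a = j a'

/-- `C_P(j) = ∏_{A ∈ P} C {Z_{j(a)}}_{a ∈ A}`. -/
def cumulantProd {Ω : Type*} [MeasurableSpace Ω] (μ : Measure Ω) (Z : ℤ → Ω → ℝ) {k : ℕ}
    (P : Part k) (j : Pos k → ℤ) : ℝ :=
  ∏ A ∈ P.parts, jointCumulant μ (fun a => Z (j a)) A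

/-- The contribution of the partition `P` to `p⁻¹ E trace Y^k`:
`p⁻¹ n^{-k + #(Π₀ ∨ P)} ∑_j B(j) C_P(j)`, the sum being over the `Π₁`-measurable words
`j : Pos k → {1, …, p}`, with `B(j) = ∏_t B(j(2t-1), j(2t))`. -/
def contribution {Ω : Type*} [MeasurableSpace Ω] (μ : Measure Ω) (Z : ℤ → Ω → ℝ)
    (b : ℝ) (n p : ℕ) {k : ℕ} (P : Part k) : ℝ := by
  classical exact
    (p : ℝ)⁻¹ * (n : ℝ) ^ (-(k : ℤ) + (cardJoin (matching0 k) P : ℤ)) *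
      ∑ j ∈ (Finset.univ : Finset (Pos k → Fin p)).filter (fun j => IsMeas (matching1 k) j),
        (∏ t : Fin k, bandMatrix b p (j (t, false)) (j (t, true))) *
          cumulantProd μ Z P (fun a => ((j a : ℕ) : ℤ) + 1)

end

end BandedCov

open BandedCov

/-!
The expected trace of `Y ^ k` is a sum over cyclic words `i` of length `k` with letters in
`{1, …, p}`, and over assignments of rows to the `k` factors, of mixed moments of the entries. The
moment-cumulant formula, applied within each independent row, turns a mixed moment into a sum over
the set partitions `P` of the `2k` positions whose blocks stay within one row
(`integral_prod_copy_eq_sum`). Counting the row assignments gives the power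
`n ^ #(Π₀ ∨ P)` (`card_isMeas_fst`), and the centering removes the partitions with a singleton
block: this is `expected_trace_eq_sum_contribution`. The moment-cumulant formula is derived from the
recursion `m(s) = ∑_{a ∈ A ⊆ s} κ(A) m(s \ A)` (`moment_eq_sum_cumulantOf`), which rests on splitting
one block off a partition (`sum_finpartition_erase`).

For `P ≠ Π₀` the contribution tends to zero by power counting. Pin one letter in each block of
`Π₁ ∨ P`. The remaining letters are linked to the pinned ones through blocks of `P`, so the
summability of the cumulants bounds the sum over them (`tsum_pinned_le`), while the banding matrix
forces the pinned letters to lie within `2kb` of each other. Hence the sum over words is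
`O(p b ^ (#(Π₁ ∨ P) - 1))` (`exists_sum_band_cumulant_le`). The inequality
`#(Π₀ ∨ P) + #(Π₁ ∨ P) ≤ k + 1` (`cardJoin_add_cardJoin_le`) makes the contribution
`O((b / n) ^ s n ^ (-d))` with `s, d ≥ 0`, and `s = d = 0` forces `#(Π₀ ∨ P) = k`, that is,
`P = Π₀` (`eq_matching0_of_cardJoin_eq`).

The contribution of `Π₀` is exactly the normalized trace of the `k`-th power of the banded Toeplitz
matrix with symbol `R` (`contribution_matching0`). In the average over rows, its powers are
`ℓ¹`-close to the infinite Toeplitz matrices with symbols `R^{(m)}`: both the mass outside the band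
and the mass lost at the boundary of `[1, p]` are negligible (`tendsto_trace_toeplitz_pow`).
Finally, `R^{(k)}` is the sequence of Fourier coefficients of the `k`-th power of the spectral
density (`hasSum_specDensity_pow`).
-/

namespace BandedCov

open scoped ENNReal

/-! ### Set partitions and the moment-cumulant formula -/

section Cumulant

variable {ι κ : Type*} [DecidableEq ι] [DecidableEq κ]

/-- The partition of `s \ B` left over when the block `B` of a partition of `s` is removed. -/
def eraseBlock {s : Finset ι} (P : Finpartition s) (B : Finset ι) (hB : B ∈ P.parts) :
    Finpartition (s \ B) where
  parts := P.parts.erase B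
  supIndep := P.supIndep.subset (Finset.erase_subset _ _)
  bot_notMem h := P.bot_notMem (Finset.mem_of_mem_erase h)
  sup_parts := by
    ext x
    simp only [Finset.mem_sup, Finset.mem_erase, id, Finset.mem_sdiff]
    constructor
    · rintro ⟨A, ⟨hne, hA⟩, hx⟩
      exact ⟨P.subset hA hx, fun hxB => hne (P.eq_of_mem_parts hA hB hx hxB)⟩
    · rintro ⟨hx, hxB⟩
      obtain ⟨A, hA, hxA⟩ := P.exists_mem hx
      exact ⟨A, ⟨fun h => hxB (h ▸ hxA), hA⟩, hxA⟩

/-- Choosing a partition of `s` together with one of its blocks amounts to choosing a nonempty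
subset of `s` and a partition of its complement. -/
theorem sum_finpartition_erase (F : Finset ι → Finset (Finset ι) → ℝ) (s : Finset ι) :
    ∑ P : Finpartition s, ∑ B ∈ P.parts, F B (P.parts.erase B) =
      ∑ B ∈ s.powerset.filter Finset.Nonempty, ∑ P : Finpartition (s \ B), F B P.parts := by
  rw [Finset.sum_sigma', Finset.sum_sigma']
  refine Finset.sum_bij
    (fun (x : Σ _ : Finpartition s, Finset ι) hx =>
      (⟨x.2, eraseBlock x.1 x.2 (Finset.mem_sigma.1 hx).2⟩ : Σ B, Finpartition (s \ B)))
    ?_ ?_ ?_ ?_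
  · rintro ⟨P, B⟩ hx
    have hB := (Finset.mem_sigma.1 hx).2
    simp only [Finset.mem_sigma, Finset.mem_filter, Finset.mem_powerset, Finset.mem_univ, and_true]
    exact ⟨P.subset hB, P.nonempty_of_mem_parts hB⟩
  · rintro ⟨P, B⟩ hx ⟨P', B'⟩ hx' h
    have hB : B ∈ P.parts := (Finset.mem_sigma.1 hx).2
    have hB' : B' ∈ P'.parts := (Finset.mem_sigma.1 hx').2
    have h1 : B = B' := congrArg Sigma.fst h
    have h2 : P.parts.erase B = P'.parts.erase B' :=
      congrArg (fun y : Σ B, Finpartition (s \ B) => y.2.parts) h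
    subst h1
    have h3 : P = P' := by
      apply Finpartition.ext
      rw [← Finset.insert_erase hB, ← Finset.insert_erase hB', h2]
    rw [h3]
  · rintro ⟨B, P⟩ hx
    simp only [Finset.mem_sigma, Finset.mem_filter, Finset.mem_powerset, Finset.mem_univ,
      and_true] at hx
    have hd : Disjoint (s \ B) B := Finset.sdiff_disjoint
    have hc : (s \ B) ⊔ B = s := Finset.sdiff_union_of_subset hx.1
    have hnot : B ∉ P.parts := fun h => by
      obtain ⟨x, hxB⟩ := hx.2
      exact (Finset.mem_sdiff.1 (P.subset h hxB)).2 hxB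
    refine ⟨⟨P.extend hx.2.ne_empty hd hc, B⟩, ?_, ?_⟩
    · simp
    · refine Sigma.ext rfl (heq_of_eq (Finpartition.ext ?_))
      simp [eraseBlock, Finset.erase_insert hnot]
  · rintro ⟨P, B⟩ hx
    rfl

/-- Splitting off the block of a fixed element `a`. -/
theorem sum_finpartition_prod_eq (c : Finset ι → ℝ) {s : Finset ι} {a : ι} (ha : a ∈ s) :
    ∑ P : Finpartition s, ∏ A ∈ P.parts, c A =
      ∑ A ∈ s.powerset.filter (a ∈ ·),
        c A * ∑ P : Finpartition (s \ A), ∏ B ∈ P.parts, c B := by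
  have h := sum_finpartition_erase (fun B Q => if a ∈ B then c B * ∏ A ∈ Q, c A else 0) s
  have hl : ∀ P : Finpartition s, ∑ B ∈ P.parts,
      (if a ∈ B then c B * ∏ A ∈ P.parts.erase B, c A else 0) = ∏ A ∈ P.parts, c A := by
    intro P
    rw [Finset.sum_eq_single (P.part a)]
    · rw [if_pos (P.mem_part_self.2 ha), Finset.mul_prod_erase _ _ (P.part_mem.2 ha)]
    · intro B hB hne
      rw [if_neg]
      exact fun haB => hne (P.part_eq_of_mem hB haB).symm
    · exact fun h => absurd (P.part_mem.2 ha) h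
  simp only [hl] at h
  rw [h]
  symm
  have hsub : s.powerset.filter (a ∈ ·) ⊆ s.powerset.filter Finset.Nonempty := fun A hA => by
    simp only [Finset.mem_filter] at hA ⊢
    exact ⟨hA.1, a, hA.2⟩
  rw [← Finset.sum_subset hsub]
  · refine Finset.sum_congr rfl fun A hA => ?_
    simp only [if_pos (Finset.mem_filter.1 hA).2, Finset.mul_sum]
  · intro B hB hB'
    have : a ∉ B := fun h => hB' (Finset.mem_filter.2 ⟨(Finset.mem_filter.1 hB).1, h⟩)
    simp [this]

/-- The cumulant attached to a moment function `m` on finite sets. On the empty set, whose only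
partition has no blocks, truncated subtraction gives the value `1`, which is never used. -/
noncomputable def cumulantOf (m : Finset ι → ℝ) (s : Finset ι) : ℝ :=
  ∑ P : Finpartition s, (-1 : ℝ) ^ (P.parts.card - 1) * ((P.parts.card - 1).factorial : ℝ) *
    ∏ A ∈ P.parts, m A

/-- The recursion that determines cumulants from moments. Expanding the cumulants, a partition of
`s` with `N` blocks arises once from `A = s` and once from each of its `N - 1` blocks `s \ A` not
containing `a`; the two kinds of weights cancel unless `N = 1`. -/
theorem moment_eq_sum_cumulantOf (m : Finset ι → ℝ) (h0 : m ∅ = 1) {s : Finset ι} {a : ι}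
    (ha : a ∈ s) :
    m s = ∑ A ∈ s.powerset.filter (a ∈ ·), cumulantOf m A * m (s \ A) := by
  have hs : s.Nonempty := ⟨a, ha⟩
  set w : ℕ → ℝ := fun N => (-1 : ℝ) ^ (N - 1) * ((N - 1).factorial : ℝ) with hw
  have h := sum_finpartition_erase
    (fun B Q => if a ∈ B then 0 else m B * (w Q.card * ∏ A ∈ Q, m A)) s
  have hl : ∀ P : Finpartition s, ∑ B ∈ P.parts,
      (if a ∈ B then 0 else m B * (w (P.parts.erase B).card * ∏ A ∈ P.parts.erase B, m A)) =
        ((P.parts.card - 1 : ℕ) : ℝ) * w (P.parts.card - 1) * ∏ A ∈ P.parts, m A := by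
    intro P
    have hpa := P.part_mem.2 ha
    rw [← Finset.add_sum_erase _ _ hpa, if_pos (P.mem_part_self.2 ha), zero_add]
    rw [Finset.sum_congr rfl (g := fun _ => w (P.parts.card - 1) * ∏ A ∈ P.parts, m A)]
    · rw [Finset.sum_const, Finset.card_erase_of_mem hpa, nsmul_eq_mul]
      simp only [hw]
      ring
    · intro B hB
      obtain ⟨hne, hB⟩ := Finset.mem_erase.1 hB
      rw [if_neg fun haB => hne (P.part_eq_of_mem hB haB).symm, Finset.card_erase_of_mem hB,
        ← Finset.mul_prod_erase _ _ hB]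
      ring
  simp only [hl] at h
  -- the right-hand side of `h` is the sum over proper subsets `A = s \ B` containing `a`
  have hr : ∑ B ∈ s.powerset.filter Finset.Nonempty, ∑ P : Finpartition (s \ B),
      (if a ∈ B then 0 else m B * (w P.parts.card * ∏ A ∈ P.parts, m A)) =
      ∑ A ∈ (s.powerset.filter (a ∈ ·)).erase s, cumulantOf m A * m (s \ A) := by
    rw [← Finset.sum_filter_of_ne (p := fun B => a ∉ B)]
    · refine Finset.sum_bij' (fun B _ => s \ B) (fun A _ => s \ A) ?_ ?_ ?_ ?_ ?_
      · intro B hB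
        simp only [Finset.mem_filter, Finset.mem_powerset, Finset.mem_erase] at hB ⊢
        refine ⟨fun h => ?_, Finset.sdiff_subset, ?_⟩
        · obtain ⟨x, hx⟩ := hB.1.2
          have := hB.1.1 hx
          rw [← h] at this
          exact (Finset.mem_sdiff.1 this).2 hx
        · exact Finset.mem_sdiff.2 ⟨ha, hB.2⟩
      · intro A hA
        simp only [Finset.mem_filter, Finset.mem_powerset, Finset.mem_erase] at hA ⊢
        refine ⟨⟨Finset.sdiff_subset, ?_⟩, fun h => (Finset.mem_sdiff.1 h).2 hA.2.2⟩
        rw [Finset.sdiff_nonempty]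
        exact fun h => hA.1 (Finset.Subset.antisymm hA.2.1 h)
      · intro B hB
        simp only [Finset.mem_filter, Finset.mem_powerset] at hB
        exact Finset.sdiff_sdiff_eq_self hB.1.1
      · intro A hA
        simp only [Finset.mem_filter, Finset.mem_powerset, Finset.mem_erase] at hA
        exact Finset.sdiff_sdiff_eq_self hA.2.1
      · intro B hB
        simp only [Finset.mem_filter, Finset.mem_powerset] at hB
        simp only [if_neg hB.2, cumulantOf, Finset.sdiff_sdiff_eq_self hB.1.1, hw]
        rw [← Finset.mul_sum, mul_comm]
    · intro B _ hne haB
      exact hne (by simp [haB])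
  rw [hr] at h
  have hsm : s ∈ s.powerset.filter (a ∈ ·) := by simp [ha]
  rw [← Finset.add_sum_erase _ _ hsm, ← h, Finset.sdiff_self, h0, mul_one, cumulantOf,
    ← Finset.sum_add_distrib]
  rw [Finset.sum_eq_single (Finpartition.indiscrete hs.ne_empty)]
  · simp
  · intro P _ hne
    have hc0 : 0 < P.parts.card := Finset.card_pos.2 (P.parts_nonempty hs.ne_empty)
    have hc : P.parts.card ≠ 1 := by
      intro h1
      obtain ⟨B, hB⟩ := Finset.card_eq_one.1 h1
      apply hne
      apply Finpartition.ext
      have := P.biUnion_parts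
      rw [hB] at this ⊢
      simpa using this
    obtain ⟨N, hN⟩ : ∃ N, P.parts.card = N + 2 := ⟨P.parts.card - 2, by omega⟩
    rw [hN]
    simp only [hw, show N + 2 - 1 = N + 1 from rfl, show N + 1 - 1 = N from rfl,
      Nat.factorial_succ]
    push_cast
    ring
  · simp

/-- The moment-cumulant formula in abstract form: the recursion of `moment_eq_sum_cumulantOf`
forces a function to be the sum over partitions of the products of its cumulants. -/
theorem eq_sum_finpartition_of_recursion (M c : Finset ι → ℝ) (h0 : M ∅ = 1)
    (hrec : ∀ s : Finset ι, ∀ a ∈ s,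
      M s = ∑ A ∈ s.powerset.filter (a ∈ ·), c A * M (s \ A)) (s : Finset ι) :
    M s = ∑ P : Finpartition s, ∏ A ∈ P.parts, c A := by
  induction s using Finset.strongInduction with
  | H s ih =>
    rcases s.eq_empty_or_nonempty with rfl | ⟨a, ha⟩
    · have : Unique (Finpartition (∅ : Finset ι)) :=
        inferInstanceAs (Unique (Finpartition (⊥ : Finset ι)))
      rw [Fintype.sum_unique, h0]
      have : (default : Finpartition (∅ : Finset ι)).parts = ∅ := by
        rw [Finpartition.parts_eq_empty_iff]; rfl
      rw [this, Finset.prod_empty]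
    · rw [hrec s a ha, sum_finpartition_prod_eq c ha]
      refine Finset.sum_congr rfl fun A hA => ?_
      simp only [Finset.mem_filter, Finset.mem_powerset] at hA
      rw [ih (s \ A) (Finset.sdiff_ssubset hA.1 ⟨a, hA.2⟩)]

/-- Cumulants are invariant under relabelling of the variables. -/
theorem cumulantOf_map (m : Finset κ → ℝ) (h0 : m ∅ = 1) (f : ι ↪ κ) (s : Finset ι)
    (hs : s.Nonempty) :
    cumulantOf m (s.map f) = cumulantOf (fun A => m (A.map f)) s := by
  induction s using Finset.strongInduction with
  | H s ih =>
    obtain ⟨a, ha⟩ := hs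
    have h1 := moment_eq_sum_cumulantOf m h0 (Finset.mem_map_of_mem f ha)
    have h2 := moment_eq_sum_cumulantOf (fun A => m (A.map f)) (by simpa using h0) ha
    have h3 : ∑ A ∈ (s.map f).powerset.filter (f a ∈ ·), cumulantOf m A * m (s.map f \ A) =
        ∑ A ∈ s.powerset.filter (a ∈ ·), cumulantOf m (A.map f) * m ((s \ A).map f) := by
      symm
      refine Finset.sum_bij (fun A _ => A.map f) ?_ ?_ ?_ ?_
      · intro A hA
        simpa using hA
      · intro A _ B _ h
        exact Finset.map_injective f h
      · intro B hB
        simp only [Finset.mem_filter, Finset.mem_powerset] at hB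
        obtain ⟨A, hA, rfl⟩ := Finset.subset_map_iff.1 hB.1
        exact ⟨A, by simpa [hA] using hB.2, rfl⟩
      · intro A _
        rw [Finset.map_sdiff]
    have hsm : s ∈ s.powerset.filter (a ∈ ·) := by simp [ha]
    rw [h3, ← Finset.add_sum_erase _ _ hsm] at h1
    rw [← Finset.add_sum_erase _ _ hsm] at h2
    have h4 : ∑ A ∈ (s.powerset.filter (a ∈ ·)).erase s,
        cumulantOf m (A.map f) * m ((s \ A).map f) =
        ∑ A ∈ (s.powerset.filter (a ∈ ·)).erase s,
        cumulantOf (fun A => m (A.map f)) A * m ((s \ A).map f) := by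
      refine Finset.sum_congr rfl fun A hA => ?_
      simp only [Finset.mem_filter, Finset.mem_powerset, Finset.mem_erase] at hA
      rw [ih A (lt_of_le_of_ne hA.2.1 hA.1) ⟨a, hA.2.2⟩]
    rw [h4] at h1
    simp only [Finset.sdiff_self, Finset.map_empty, h0, mul_one] at h1 h2
    linarith

theorem cumulantOf_singleton (m : Finset ι → ℝ) (h0 : m ∅ = 1) (a : ι) :
    cumulantOf m {a} = m {a} := by
  rw [moment_eq_sum_cumulantOf m h0 (Finset.mem_singleton_self a), Finset.sum_eq_single {a}]
  · simp [h0]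
  · intro A hA hne
    simp only [Finset.mem_filter, Finset.mem_powerset] at hA
    exact absurd ((Finset.Nonempty.subset_singleton_iff ⟨a, hA.2⟩).1 hA.1) hne
  · simp

theorem cumulantOf_pair (m : Finset ι → ℝ) (h0 : m ∅ = 1) {a b : ι} (hab : a ≠ b)
    (ha : m {a} = 0) :
    cumulantOf m {a, b} = m {a, b} := by
  have hmem : a ∈ ({a, b} : Finset ι) := by simp
  rw [moment_eq_sum_cumulantOf m h0 hmem, Finset.sum_eq_single {a, b}]
  · simp [h0]
  · intro A hA hne
    simp only [Finset.mem_filter, Finset.mem_powerset] at hA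
    have : A = {a} := by
      apply Finset.Subset.antisymm _ (Finset.singleton_subset_iff.2 hA.2)
      intro x hx
      rcases Finset.mem_insert.1 (hA.1 hx) with rfl | h
      · simp
      · rw [Finset.mem_singleton] at h
        subst h
        refine absurd (Finset.Subset.antisymm hA.1 ?_) hne
        intro y hy
        rcases Finset.mem_insert.1 hy with rfl | h'
        · exact hA.2
        · rw [Finset.mem_singleton] at h'
          rwa [h']
    rw [this, cumulantOf_singleton m h0, ha, zero_mul]
  · simp

end Cumulant

/-! ### Convolution powers and the spectral density -/

section Convolution

/-- The shear `(i, l) ↦ (i - l, l)` of `ℤ × ℤ`. -/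
def shear : ℤ × ℤ ≃ ℤ × ℤ where
  toFun x := (x.1 - x.2, x.2)
  invFun x := (x.1 + x.2, x.2)
  left_inv x := by simp
  right_inv x := by simp

/-- The convolution series of two absolutely summable families, jointly in both indices. -/
theorem hasSum_convolution {F G : ℤ → ℂ} {f g : ℂ} (hF : HasSum F f) (hG : HasSum G g)
    (hF' : Summable fun i => ‖F i‖) (hG' : Summable fun i => ‖G i‖) :
    HasSum (fun i => ∑' l, F (i - l) * G l) (f * g) := by
  have h1 : HasSum (fun x : ℤ × ℤ => F x.1 * G x.2) (f * g) :=
    hF.mul hG (summable_mul_of_summable_norm hF' hG')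
  have h2 : HasSum (fun x : ℤ × ℤ => F (x.1 - x.2) * G x.2) (f * g) :=
    (shear.hasSum_iff (f := fun x : ℤ × ℤ => F x.1 * G x.2)).2 h1
  exact h2.prod_fiberwise fun i => (h2.summable.prod_factor i).hasSum

theorem summable_abs_mul_shear {F G : ℤ → ℝ} (hF : Summable F) (hG : Summable G) :
    Summable fun x : ℤ × ℤ => |F (x.1 - x.2) * G x.2| := by
  have h1 : Summable fun x : ℤ × ℤ => |F x.1| * |G x.2| :=
    hF.abs.mul_of_nonneg hG.abs (fun _ => abs_nonneg _) (fun _ => abs_nonneg _)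
  have h2 := (shear.summable_iff (f := fun x : ℤ × ℤ => |F x.1| * |G x.2|)).2 h1
  refine h2.congr fun x => ?_
  simp [shear, abs_mul]

theorem summable_convPow {R : ℤ → ℝ} (hR : Summable R) (m : ℕ) : Summable (convPow R m) := by
  induction m with
  | zero =>
    refine summable_of_ne_finset_zero (s := {0}) fun i hi => ?_
    simp only [Finset.mem_singleton] at hi
    simp [convPow, hi]
  | succ m ih => exact (summable_abs_mul_shear ih hR).of_abs.prod

theorem summable_convPow_mul {R : ℤ → ℝ} (hR : Summable R) (m : ℕ) (i : ℤ) :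
    Summable fun l : ℤ => convPow R m (i - l) * R l :=
  ((summable_abs_mul_shear (summable_convPow hR m) hR).prod_factor i).of_abs

/-- The character `θ ↦ e^{2π i j θ}`. -/
noncomputable def character (j : ℤ) (θ : ℝ) : ℂ :=
  Complex.exp (2 * Real.pi * Complex.I * j * θ)

theorem character_eq (j : ℤ) (θ : ℝ) :
    character j θ = Complex.exp (((2 * Real.pi * j * θ : ℝ) : ℂ) * Complex.I) := by
  rw [character]
  congr 1
  push_cast
  ring

theorem norm_character (j : ℤ) (θ : ℝ) : ‖character j θ‖ = 1 := by
  rw [character_eq, Complex.norm_exp_ofReal_mul_I]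

theorem character_add (i j : ℤ) (θ : ℝ) :
    character (i + j) θ = character i θ * character j θ := by
  rw [character, character, character, ← Complex.exp_add]
  congr 1
  push_cast
  ring

theorem conj_character (j : ℤ) (θ : ℝ) :
    (starRingEnd ℂ) (character j θ) = character (-j) θ := by
  rw [character_eq, character_eq, ← Complex.exp_conj, map_mul, Complex.conj_ofReal,
    Complex.conj_I]
  congr 1
  push_cast
  ring

theorem continuous_character (j : ℤ) : Continuous (character j) := by
  unfold character
  fun_prop

theorem summable_norm_character_mul {a : ℤ → ℝ} (ha : Summable a) (θ : ℝ) :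
    Summable fun j => ‖character j θ * (a j : ℂ)‖ := by
  simpa [norm_character] using ha.abs

theorem integral_character (j : ℤ) :
    ∫ θ in (0 : ℝ)..1, character j θ = if j = 0 then 1 else 0 := by
  split_ifs with hj
  · simp [hj, character]
  · have hc : (2 * Real.pi * Complex.I * j : ℂ) ≠ 0 := by
      simp [Real.pi_ne_zero, hj]
    simp only [character]
    rw [integral_exp_mul_complex hc]
    have : (2 * Real.pi * Complex.I * j : ℂ) * (1 : ℝ) = j * (2 * Real.pi * Complex.I) := by
      push_cast
      ring
    rw [this, Complex.exp_int_mul_two_pi_mul_I]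
    simp

/-- The spectral density of an even summable sequence is real valued. -/
theorem hasSum_specDensity {R : ℤ → ℝ} (hR : Summable R) (heven : ∀ j, R (-j) = R j) (θ : ℝ) :
    HasSum (fun j : ℤ => character j θ * (R j : ℂ)) (specDensity R θ : ℂ) := by
  have hs : Summable fun j : ℤ => character j θ * (R j : ℂ) :=
    (summable_norm_character_mul hR θ).of_norm
  have hconj : (starRingEnd ℂ) (∑' j : ℤ, character j θ * (R j : ℂ)) =
      ∑' j : ℤ, character j θ * (R j : ℂ) := by
    rw [Complex.conj_tsum, ← (Equiv.neg ℤ).tsum_eq]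
    refine tsum_congr fun j => ?_
    simp [conj_character, heven]
  have hre : ((specDensity R θ : ℝ) : ℂ) = ∑' j : ℤ, character j θ * (R j : ℂ) :=
    Complex.conj_eq_iff_re.1 hconj
  rw [hre]
  exact hs.hasSum

/-- The convolution powers are the Fourier coefficients of the powers of the spectral density. -/
theorem hasSum_specDensity_pow {R : ℤ → ℝ} (hR : Summable R) (heven : ∀ j, R (-j) = R j)
    (m : ℕ) (θ : ℝ) :
    HasSum (fun j : ℤ => character j θ * (convPow R m j : ℂ)) ((specDensity R θ : ℂ) ^ m) := by
  induction m with
  | zero =>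
    have h := hasSum_ite_eq (0 : ℤ) (1 : ℂ)
    rw [pow_zero]
    refine h.congr_fun fun j => ?_
    by_cases hj : j = 0 <;> simp [convPow, hj, character]
  | succ m ih =>
    have h := hasSum_convolution ih (hasSum_specDensity hR heven θ)
      (summable_norm_character_mul (summable_convPow hR m) θ) (summable_norm_character_mul hR θ)
    rw [pow_succ]
    refine h.congr_fun fun i => ?_
    rw [convPow, Complex.ofReal_tsum, ← tsum_mul_left]
    refine tsum_congr fun l => ?_
    have : character i θ = character (i - l) θ * character l θ := by
      rw [← character_add, sub_add_cancel]
    rw [this]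
    push_cast
    ring

theorem continuous_specDensity {R : ℤ → ℝ} (hR : Summable R) : Continuous (specDensity R) := by
  have h : Continuous fun θ => ∑' j : ℤ, character j θ * (R j : ℂ) := by
    refine continuous_tsum (u := fun j => |R j|)
      (fun j => (continuous_character j).mul continuous_const) hR.abs fun j θ => ?_
    simp [norm_character]
  exact Complex.continuous_re.comp h

theorem integral_specDensity_pow {R : ℤ → ℝ} (hR : Summable R) (heven : ∀ j, R (-j) = R j)
    (m : ℕ) : ∫ θ in (0 : ℝ)..1, specDensity R θ ^ m = convPow R m 0 := by
  have h := intervalIntegral.hasSum_integral_of_dominated_convergence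
    (μ := volume) (a := 0) (b := 1)
    (F := fun (j : ℤ) θ => character j θ * (convPow R m j : ℂ))
    (f := fun θ => (specDensity R θ : ℂ) ^ m)
    (fun j _ => |convPow R m j|)
    (fun j => ((continuous_character j).mul continuous_const).aestronglyMeasurable)
    (fun j => .of_forall fun θ _ => by simp [norm_character])
    (.of_forall fun θ _ => (summable_convPow hR m).abs)
    (by simp)
    (.of_forall fun θ _ => hasSum_specDensity_pow hR heven m θ)
  have h2 : HasSum (fun j : ℤ => ∫ θ in (0 : ℝ)..1, character j θ * (convPow R m j : ℂ))
      (convPow R m 0 : ℂ) := by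
    have := hasSum_ite_eq (0 : ℤ) (convPow R m 0 : ℂ)
    refine this.congr_fun fun j => ?_
    rw [intervalIntegral.integral_mul_const, integral_character]
    by_cases hj : j = 0 <;> simp [hj]
  have h3 := h.unique h2
  have h4 : ∫ θ in (0 : ℝ)..1, (specDensity R θ : ℂ) ^ m =
      ((∫ θ in (0 : ℝ)..1, specDensity R θ ^ m : ℝ) : ℂ) := by
    rw [← intervalIntegral.integral_ofReal]
    push_cast
    rfl
  rw [h4] at h3
  exact_mod_cast h3

end Convolution

/-! ### Traces of powers as sums over cyclic words -/

section Trace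

variable {α : Type*} [Fintype α] [DecidableEq α]

theorem matrix_pow_apply_eq_sum (M : Matrix α α ℝ) (m : ℕ) (x y : α) :
    (M ^ (m + 1)) x y = ∑ e : Fin m → α, ∏ t : Fin (m + 1),
      M ((Fin.cons x e : Fin (m + 1) → α) t) ((Fin.snoc e y : Fin (m + 1) → α) t) := by
  induction m generalizing x with
  | zero => simp [Fin.snoc]
  | succ m ih =>
    rw [pow_succ', Matrix.mul_apply, ← (Fin.consEquiv fun _ : Fin (m + 1) => α).sum_comp,
      Fintype.sum_prod_type]
    refine Finset.sum_congr rfl fun z _ => ?_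
    rw [ih z, Finset.mul_sum]
    refine Finset.sum_congr rfl fun e _ => ?_
    rw [Fin.prod_univ_succ (n := m + 1)]
    simp only [Fin.consEquiv, Equiv.coe_fn_mk, ← Fin.cons_snoc_eq_snoc_cons, Fin.cons_zero,
      Fin.cons_succ]

theorem trace_pow_eq_sum_cyclic (M : Matrix α α ℝ) {k : ℕ} (hk : 0 < k) :
    (M ^ k).trace = ∑ i : Fin k → α, ∏ t : Fin k, M (i t) (i (finRotate k t)) := by
  obtain ⟨m, rfl⟩ : ∃ m, k = m + 1 := ⟨k - 1, by omega⟩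
  rw [Matrix.trace, ← (Fin.consEquiv fun _ : Fin (m + 1) => α).sum_comp, Fintype.sum_prod_type]
  refine Finset.sum_congr rfl fun x _ => ?_
  rw [Matrix.diag_apply, matrix_pow_apply_eq_sum]
  refine Finset.sum_congr rfl fun e _ => ?_
  refine Finset.prod_congr rfl fun t _ => ?_
  rw [Fin.snoc_eq_cons_rotate]
  rfl

end Trace

/-! ### Banded Toeplitz matrices -/

section Toeplitz

/-- The banded `p × p` Toeplitz matrix with symbol `R`. -/
noncomputable def toeplitz (R : ℤ → ℝ) (b : ℝ) (p : ℕ) : Matrix (Fin p) (Fin p) ℝ :=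
  Matrix.of fun x y => bandMatrix b p x y * R ((y : ℤ) - (x : ℤ))

theorem bandMatrix_apply (b : ℝ) (p : ℕ) (x y : Fin p) :
    bandMatrix b p x y = if |(x : ℝ) - (y : ℝ)| ≤ b then 1 else 0 := by
  simp [bandMatrix]

theorem sum_fin_le_tsum {p : ℕ} {a : ℤ → ℝ} (ha : Summable a) (h0 : ∀ i, 0 ≤ a i)
    (f : Fin p → ℤ) (hf : Function.Injective f) : ∑ x, a (f x) ≤ ∑' i, a i := by
  rw [← tsum_fintype (fun x => a (f x)) (L := .unconditional _)]
  exact Summable.tsum_le_tsum_of_inj f hf (fun i _ => h0 i) (fun _ => le_rfl)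
    (Summable.of_finite) ha

theorem injective_coe_sub {p : ℕ} (z : ℤ) : Function.Injective fun y : Fin p => (y : ℤ) - z := by
  intro y y' h
  simp only [sub_left_inj, Nat.cast_inj] at h
  exact Fin.ext h

/-- The mass of `R` outside the band. -/
noncomputable def bandTail (R : ℤ → ℝ) (b : ℝ) : ℝ :=
  ∑' d : ℤ, if |(d : ℝ)| ≤ b then 0 else |R d|

theorem summable_bandTail {R : ℤ → ℝ} (hR : Summable R) (b : ℝ) :
    Summable fun d : ℤ => if |(d : ℝ)| ≤ b then 0 else |R d| := by
  refine hR.abs.of_nonneg_of_le (fun d => ?_) fun d => ?_ <;> split_ifs <;> simp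

theorem tendsto_bandTail {R : ℤ → ℝ} (hR : Summable R) {b : ℕ → ℝ} (hb : Tendsto b atTop atTop) :
    Tendsto (fun p => bandTail R (b p)) atTop (𝓝 0) := by
  have h := tendsto_tsum_of_dominated_convergence (𝓕 := atTop)
    (f := fun (p : ℕ) (d : ℤ) => if |(d : ℝ)| ≤ b p then 0 else |R d|) (g := fun _ => 0)
    (bound := fun d => |R d|) hR.abs ?_ ?_
  · simpa [bandTail] using h
  · intro d
    refine tendsto_const_nhds.congr' ?_
    filter_upwards [hb.eventually_ge_atTop |(d : ℝ)|] with p hp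
    rw [if_pos hp]
  · refine .of_forall fun p d => ?_
    split_ifs <;> simp

/-- The average over rows of the mass of an infinite Toeplitz matrix outside its `p × p` block. -/
noncomputable def boundaryMass (a : ℤ → ℝ) (p : ℕ) : ℝ :=
  (p : ℝ)⁻¹ * ∑ x : Fin p, ∑' z : ℤ, if 0 ≤ z ∧ z < p then 0 else |a (z - x)|

theorem card_shift_out_le (p : ℕ) (d : ℤ) :
    (Finset.univ.filter fun x : Fin p => ¬ (0 ≤ d + x ∧ d + x < p)).card ≤ d.natAbs := by
  have h : ((Finset.univ.filter fun x : Fin p => ¬ (0 ≤ d + x ∧ d + x < p)).map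
      ⟨fun x : Fin p => (x : ℤ), fun x y h => Fin.ext (by simpa using h)⟩) ⊆
      Finset.Ico ((p : ℤ) - d) p ∪ Finset.Ico 0 (-d) := by
    intro z hz
    simp only [Finset.mem_map, Finset.mem_filter, Finset.mem_univ, true_and] at hz
    obtain ⟨x, hx, hxz⟩ := hz
    replace hxz : (x : ℤ) = z := hxz
    have := x.2
    simp only [Finset.mem_union, Finset.mem_Ico]
    omega
  have h2 := Finset.card_le_card h
  rw [Finset.card_map] at h2
  have h3 := Finset.card_union_le (Finset.Ico ((p : ℤ) - d) p) (Finset.Ico 0 (-d))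
  simp only [Int.card_Ico] at h3
  omega

theorem tendsto_boundaryMass {a : ℤ → ℝ} (ha : Summable a) :
    Tendsto (boundaryMass a) atTop (𝓝 0) := by
  -- grouping by the offset `d = z - x`, the offset `d` gets weight at most `min 1 (|d| / p)`
  have key : ∀ p, boundaryMass a p = ∑' d : ℤ, (p : ℝ)⁻¹ *
      ((Finset.univ.filter fun x : Fin p => ¬ (0 ≤ d + x ∧ d + x < p)).card : ℝ) * |a d| := by
    intro p
    have h1 : ∀ x : Fin p, ∑' z : ℤ, (if 0 ≤ z ∧ z < p then 0 else |a (z - x)|) =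
        ∑' d : ℤ, if 0 ≤ d + x ∧ d + x < p then 0 else |a d| := by
      intro x
      rw [← (Equiv.addRight (x : ℤ)).tsum_eq]
      simp
    rw [boundaryMass, Finset.sum_congr rfl fun x _ => h1 x, ← Summable.tsum_finsetSum,
      ← tsum_mul_left]
    · refine tsum_congr fun d => ?_
      rw [mul_assoc, ← nsmul_eq_mul, ← Finset.sum_const, Finset.sum_filter]
      congr 1
      refine Finset.sum_congr rfl fun x _ => ?_
      split_ifs <;> simp_all
    · intro x _
      refine ha.abs.of_nonneg_of_le (fun d => ?_) fun d => ?_ <;> split_ifs <;> simp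
  rw [funext key]
  have h := tendsto_tsum_of_dominated_convergence (𝓕 := atTop)
    (f := fun (p : ℕ) (d : ℤ) => (p : ℝ)⁻¹ *
      ((Finset.univ.filter fun x : Fin p => ¬ (0 ≤ d + x ∧ d + x < p)).card : ℝ) * |a d|)
    (g := fun _ => 0) (bound := fun d => |a d|) ha.abs ?_ ?_
  · simpa using h
  · intro d
    have h0 : Tendsto (fun p : ℕ => (p : ℝ)⁻¹ * (d.natAbs : ℝ) * |a d|) atTop (𝓝 0) := by
      have := ((tendsto_inv_atTop_nhds_zero_nat (𝕜 := ℝ)).mul_const (d.natAbs : ℝ)).mul_const |a d|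
      simpa using this
    refine squeeze_zero (fun p => by positivity) (fun p => ?_) h0
    gcongr
    exact card_shift_out_le p d
  · refine .of_forall fun p d => ?_
    rw [Real.norm_of_nonneg (by positivity)]
    refine mul_le_of_le_one_left (abs_nonneg _) ?_
    rcases Nat.eq_zero_or_pos p with rfl | hp
    · simp
    · rw [inv_mul_le_one₀ (by positivity)]
      exact_mod_cast (Finset.card_filter_le _ _).trans (by simp)

/-- The averaged `ℓ¹` distance between the rows of the `m`-th power of the banded Toeplitz matrix
and those of the infinite Toeplitz matrix with symbol `R^{(m)}`. -/
noncomputable def toeplitzError (R : ℤ → ℝ) (b : ℝ) (m p : ℕ) : ℝ :=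
  (p : ℝ)⁻¹ * ∑ x : Fin p, ∑ y : Fin p, |(toeplitz R b p ^ m) x y - convPow R m ((y : ℤ) - x)|

theorem convPow_succ_eq {R : ℤ → ℝ} (m p : ℕ) (hR : Summable R) (x y : ℤ) :
    convPow R (m + 1) (y - x) = ∑ z : Fin p, convPow R m ((z : ℤ) - x) * R (y - z) +
      ∑' z : ℤ, if 0 ≤ z ∧ z < p then 0 else convPow R m (z - x) * R (y - z) := by
  have hs : Summable fun z : ℤ => convPow R m (z - x) * R (y - z) := by
    have := (Equiv.subLeft y).summable_iff.2 (summable_convPow_mul hR m (y - x))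
    refine this.congr fun z => ?_
    simp only [Function.comp, Equiv.subLeft_apply]
    congr 2
    ring
  have h1 : convPow R (m + 1) (y - x) = ∑' z : ℤ, convPow R m (z - x) * R (y - z) := by
    rw [convPow, ← (Equiv.subLeft y).tsum_eq]
    refine tsum_congr fun z => ?_
    simp only [Equiv.subLeft_apply]
    rw [sub_sub_cancel]
    congr 2
    ring
  have h2 : ∑ z : Fin p, convPow R m ((z : ℤ) - x) * R (y - z) =
      ∑ z ∈ Finset.Ico (0 : ℤ) p, convPow R m (z - x) * R (y - z) := by
    refine Finset.sum_bij (fun z _ => (z : ℤ)) ?_ ?_ ?_ ?_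
    · intro z _
      simp
    · intro z _ z' _ h
      exact Fin.ext (by simpa using h)
    · intro z hz
      rw [Finset.mem_Ico] at hz
      exact ⟨⟨z.toNat, by omega⟩, Finset.mem_univ _, by simp [hz.1]⟩
    · intro z _
      rfl
  rw [h1, h2, ← hs.sum_add_tsum_compl (s := Finset.Ico (0 : ℤ) p)]
  congr 1
  refine (tsum_subtype _ fun z : ℤ => convPow R m (z - x) * R (y - z)).trans ?_
  refine tsum_congr fun z => ?_
  by_cases hz : 0 ≤ z ∧ z < p
  · rw [if_pos hz, Set.indicator_of_notMem]
    simpa using hz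
  · rw [if_neg hz, Set.indicator_of_mem]
    simpa using hz

theorem abs_tsum_le_of_eq {f g : ℤ → ℝ} (h : ∀ z, |f z| = g z) (hg : Summable g) :
    |∑' z, f z| ≤ ∑' z, g z := by
  obtain rfl : (fun z => |f z|) = g := funext h
  exact norm_tsum_le_tsum_norm (f := f) hg

theorem abs_sum_mul_sub_le {α : Type*} [Fintype α] (A T c r : α → ℝ) (t : ℝ) :
    |∑ z, A z * T z - (∑ z, c z * r z + t)| ≤
      (∑ z, |A z - c z| * |T z|) + (∑ z, |c z| * |T z - r z|) + |t| := by
  have hsplit : ∑ z, A z * T z - (∑ z, c z * r z + t) =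
      (∑ z, (A z - c z) * T z) + (∑ z, c z * (T z - r z)) - t := by
    rw [← sub_sub, ← Finset.sum_sub_distrib, ← Finset.sum_add_distrib]
    congr 1
    refine Finset.sum_congr rfl fun z _ => ?_
    ring
  rw [hsplit]
  refine (abs_sub _ _).trans (add_le_add ((abs_add_le _ _).trans (add_le_add ?_ ?_)) le_rfl)
  · exact (Finset.abs_sum_le_sum_abs _ _).trans_eq (Finset.sum_congr rfl fun z _ => abs_mul _ _)
  · exact (Finset.abs_sum_le_sum_abs _ _).trans_eq (Finset.sum_congr rfl fun z _ => abs_mul _ _)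

/-- One more factor costs the previous error, the mass outside the band, and the mass lost at the
boundary. -/
theorem toeplitzError_succ_le {R : ℤ → ℝ} (hR : Summable R) (b : ℝ) (m p : ℕ) :
    toeplitzError R b (m + 1) p ≤ toeplitzError R b m p * (∑' d, |R d|) +
      (∑' d, |convPow R m d|) * bandTail R b + boundaryMass (convPow R m) p * (∑' d, |R d|) := by
  have hC := summable_convPow hR m
  set S := ∑' d, |R d| with hS
  set C := ∑' d, |convPow R m d| with hCdef
  have hS0 : 0 ≤ S := tsum_nonneg fun _ => abs_nonneg _
  have hrow : ∀ z : ℤ, ∑ y : Fin p, |R (y - z)| ≤ S := fun z =>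
    sum_fin_le_tsum (a := fun d => |R d|) hR.abs (fun _ => abs_nonneg _) _ (injective_coe_sub z)
  have hT : ∀ z : Fin p, ∑ y : Fin p, |toeplitz R b p z y| ≤ S := by
    intro z
    refine le_trans (Finset.sum_le_sum fun y _ => ?_) (hrow z)
    rw [toeplitz, Matrix.of_apply, bandMatrix_apply]
    split_ifs <;> simp
  have hTR : ∀ z : Fin p, ∑ y : Fin p, |toeplitz R b p z y - R (y - z)| ≤ bandTail R b := by
    intro z
    refine le_trans (Finset.sum_le_sum fun y _ => ?_)
      (sum_fin_le_tsum (summable_bandTail hR b) (fun d => by split_ifs <;> simp) _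
        (injective_coe_sub (z : ℤ)))
    rw [toeplitz, Matrix.of_apply, bandMatrix_apply, abs_sub_comm (z : ℝ)]
    push_cast
    split_ifs <;> simp
  have hCrow : ∀ x : Fin p, ∑ z : Fin p, |convPow R m ((z : ℤ) - x)| ≤ C := fun x =>
    sum_fin_le_tsum (a := fun d => |convPow R m d|) hC.abs (fun _ => abs_nonneg _) _
      (injective_coe_sub (x : ℤ))
  have hsz : ∀ x : Fin p, Summable fun z : ℤ => |convPow R m (z - x)| := fun x =>
    (Equiv.subRight (x : ℤ)).summable_iff.2 hC.abs
  have hsout : ∀ x : Fin p, Summable fun z : ℤ =>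
      if 0 ≤ z ∧ z < p then 0 else |convPow R m (z - x)| := by
    intro x
    refine (hsz x).of_nonneg_of_le (fun d => ?_) fun d => ?_ <;> split_ifs <;> simp
  have hbd : ∀ d, |R d| ≤ S := fun d => hR.abs.le_tsum d fun _ _ => abs_nonneg _
  have hsprod : ∀ x y : Fin p, Summable fun z : ℤ =>
      (if 0 ≤ z ∧ z < p then 0 else |convPow R m (z - x)|) * |R (y - z)| := by
    intro x y
    refine ((hsout x).mul_right S).of_nonneg_of_le (fun z => ?_) fun z => ?_
    · have : 0 ≤ (if 0 ≤ z ∧ z < p then 0 else |convPow R m (z - x)|) := by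
        split_ifs <;> simp
      positivity
    · refine mul_le_mul_of_nonneg_left (hbd _) ?_
      split_ifs <;> simp
  -- entrywise: replace one factor at a time, then restrict the convolution to `[0, p)`
  have hentry : ∀ x y : Fin p,
      |(toeplitz R b p ^ (m + 1)) x y - convPow R (m + 1) ((y : ℤ) - x)| ≤
      (∑ z : Fin p, |(toeplitz R b p ^ m) x z - convPow R m ((z : ℤ) - x)| *
        |toeplitz R b p z y|) +
      (∑ z : Fin p, |convPow R m ((z : ℤ) - x)| * |toeplitz R b p z y - R (y - z)|) +
      ∑' z : ℤ, (if 0 ≤ z ∧ z < p then 0 else |convPow R m (z - x)|) * |R (y - z)| := by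
    intro x y
    rw [convPow_succ_eq m p hR, pow_succ, Matrix.mul_apply]
    refine (abs_sum_mul_sub_le _ _ _ _ _).trans (add_le_add le_rfl ?_)
    have heq : ∀ z : ℤ, |if 0 ≤ z ∧ z < p then 0 else convPow R m (z - x) * R (y - z)| =
        (if 0 ≤ z ∧ z < p then 0 else |convPow R m (z - x)|) * |R (y - z)| := by
      intro z
      split_ifs <;> simp [abs_mul]
    exact abs_tsum_le_of_eq heq (hsprod x y)
  have hrowsum : ∀ x : Fin p,
      ∑ y : Fin p, |(toeplitz R b p ^ (m + 1)) x y - convPow R (m + 1) ((y : ℤ) - x)| ≤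
      (∑ z : Fin p, |(toeplitz R b p ^ m) x z - convPow R m ((z : ℤ) - x)|) * S +
      C * bandTail R b +
      (∑' z : ℤ, (if 0 ≤ z ∧ z < p then 0 else |convPow R m (z - x)|)) * S := by
    intro x
    refine (Finset.sum_le_sum fun y _ => hentry x y).trans ?_
    rw [Finset.sum_add_distrib, Finset.sum_add_distrib]
    refine add_le_add (add_le_add ?_ ?_) ?_
    · rw [Finset.sum_comm, Finset.sum_mul]
      refine Finset.sum_le_sum fun z _ => ?_
      rw [← Finset.mul_sum]
      exact mul_le_mul_of_nonneg_left (hT z) (abs_nonneg _)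
    · rw [Finset.sum_comm]
      have htail : 0 ≤ bandTail R b := tsum_nonneg fun d => by split_ifs <;> simp
      refine le_trans ?_ (mul_le_mul_of_nonneg_right (hCrow x) htail)
      rw [Finset.sum_mul]
      refine Finset.sum_le_sum fun z _ => ?_
      rw [← Finset.mul_sum]
      exact mul_le_mul_of_nonneg_left (hTR z) (abs_nonneg _)
    · rw [← Summable.tsum_finsetSum fun y _ => hsprod x y, ← tsum_mul_right]
      refine Summable.tsum_le_tsum (fun z => ?_) (summable_sum fun y _ => hsprod x y)
        ((hsout x).mul_right S)
      rw [← Finset.mul_sum]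
      refine mul_le_mul_of_nonneg_left (hrow z) ?_
      split_ifs <;> simp
  have hp0 : (0 : ℝ) ≤ (p : ℝ)⁻¹ := by positivity
  refine (mul_le_mul_of_nonneg_left (Finset.sum_le_sum fun x _ => hrowsum x) hp0).trans ?_
  rw [Finset.sum_add_distrib, Finset.sum_add_distrib, mul_add, mul_add]
  refine add_le_add (add_le_add ?_ ?_) ?_
  · rw [← Finset.sum_mul, ← mul_assoc, toeplitzError]
  · have h0 : 0 ≤ C * bandTail R b := mul_nonneg (tsum_nonneg fun _ => abs_nonneg _)
      (tsum_nonneg fun d => by split_ifs <;> simp)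
    have h1 : (p : ℝ)⁻¹ * p ≤ 1 := inv_mul_le_one
    rw [Finset.sum_const, Finset.card_univ, Fintype.card_fin, nsmul_eq_mul, ← mul_assoc]
    exact mul_le_of_le_one_left h0 h1
  · rw [← Finset.sum_mul, ← mul_assoc, boundaryMass]

theorem tendsto_toeplitzError {R : ℤ → ℝ} (hR : Summable R) {b : ℕ → ℝ}
    (hb : Tendsto b atTop atTop) (m : ℕ) :
    Tendsto (fun p => toeplitzError R (b p) m p) atTop (𝓝 0) := by
  induction m with
  | zero =>
    have h : ∀ p, toeplitzError R (b p) 0 p = 0 := by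
      intro p
      rw [toeplitzError, Finset.sum_eq_zero, mul_zero]
      intro x _
      refine Finset.sum_eq_zero fun y _ => ?_
      rw [pow_zero, Matrix.one_apply, convPow, abs_eq_zero, sub_eq_zero]
      refine if_congr ?_ rfl rfl
      rw [sub_eq_zero, Nat.cast_inj, Fin.ext_iff, eq_comm]
    simp [h]
  | succ m ih =>
    have h := ((ih.mul_const (∑' d, |R d|)).add
      ((tendsto_bandTail hR hb).const_mul (∑' d, |convPow R m d|))).add
      ((tendsto_boundaryMass (summable_convPow hR m)).mul_const (∑' d, |R d|))
    simp only [zero_mul, mul_zero, add_zero] at h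
    refine squeeze_zero (fun p => ?_) (fun p => toeplitzError_succ_le hR (b p) m p) h
    unfold toeplitzError
    positivity

/-- A Szegő-type limit theorem: the normalized traces of powers of banded Toeplitz matrices
converge. -/
theorem tendsto_trace_toeplitz_pow {R : ℤ → ℝ} (hR : Summable R) {b : ℕ → ℝ}
    (hb : Tendsto b atTop atTop) (m : ℕ) :
    Tendsto (fun p : ℕ => (p : ℝ)⁻¹ * (toeplitz R (b p) p ^ m).trace) atTop
      (𝓝 (convPow R m 0)) := by
  rw [tendsto_iff_norm_sub_tendsto_zero]
  refine squeeze_zero' (.of_forall fun p => norm_nonneg _) ?_ (tendsto_toeplitzError hR hb m)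
  filter_upwards [eventually_ge_atTop 1] with p hp
  have hp' : (p : ℝ) ≠ 0 := by positivity
  have h : (p : ℝ)⁻¹ * (toeplitz R (b p) p ^ m).trace - convPow R m 0 =
      (p : ℝ)⁻¹ * ∑ x : Fin p, ((toeplitz R (b p) p ^ m) x x - convPow R m ((x : ℤ) - x)) := by
    rw [Finset.sum_sub_distrib, mul_sub, Matrix.trace]
    simp [hp']
  rw [h, norm_mul, Real.norm_of_nonneg (by positivity), toeplitzError]
  gcongr
  refine (norm_sum_le _ _).trans (Finset.sum_le_sum fun x _ => ?_)
  exact Finset.single_le_sum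
    (f := fun y : Fin p => |(toeplitz R (b p) p ^ m) x y - convPow R m ((y : ℤ) - x)|)
    (fun _ _ => abs_nonneg _) (Finset.mem_univ x)

end Toeplitz

/-! ### Sums of products of kernels along a connected hypergraph -/

section Pinned

variable {V E : Type*} [Fintype V] [DecidableEq V] [DecidableEq E]

/-- Each kernel `G e` depends only on the coordinates in `A e` and has mass at most `K e` once one
of these coordinates is pinned. If every vertex is linked to the set `D` by hyperedges in `T`, then
the sum of the products of the kernels, with all the coordinates in `D` pinned, is at most
`∏ K e`. -/
theorem tsum_pinned_le (G : E → (V → ℤ) → ℝ≥0∞) (A : E → Finset V) (K : E → ℝ≥0∞)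
    (hdep : ∀ e j j', (∀ v ∈ A e, j v = j' v) → G e j = G e j')
    (hK : ∀ e, ∀ v ∈ A e, ∀ x : V → ℤ,
      ∑' j : V → ℤ, (if ∀ w, (w ∉ A e ∨ w = v) → j w = x w then G e j else 0) ≤ K e)
    (T : Finset E) (hne : ∀ e ∈ T, (A e).Nonempty) (D : Finset V)
    (hconn : ∀ D' : Finset V, D ⊆ D' → D' ≠ Finset.univ →
      ∃ e ∈ T, (A e ∩ D').Nonempty ∧ ¬ A e ⊆ D') (x : V → ℤ) :
    ∑' j : V → ℤ, (if ∀ v ∈ D, j v = x v then ∏ e ∈ T, G e j else 0) ≤ ∏ e ∈ T, K e := by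
  induction hN : (Finset.univ \ D).card using Nat.strong_induction_on generalizing D T x with
  | _ N ih =>
  by_cases hD : D = Finset.univ
  · subst hD
    have hone : ∀ j : V → ℤ, (if ∀ v ∈ (Finset.univ : Finset V), j v = x v then
        ∏ e ∈ T, G e j else 0) = if j = x then ∏ e ∈ T, G e x else 0 := by
      intro j
      by_cases hj : j = x
      · simp [hj]
      · rw [if_neg hj, if_neg]
        exact fun h => hj (funext fun v => h v (Finset.mem_univ v))
    rw [tsum_congr hone, tsum_ite_eq]
    refine Finset.prod_le_prod' fun e he => ?_
    obtain ⟨v, hv⟩ := hne e he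
    refine le_trans ?_ ((ENNReal.le_tsum x).trans (hK e v hv x))
    simp
  · obtain ⟨e, heT, ⟨v, hv⟩, hnsub⟩ := hconn D subset_rfl hD
    rw [Finset.mem_inter] at hv
    set D' := D ∪ A e with hD'
    -- first sum over the coordinates outside `D'`, then over those in `A e \ D`
    have hstep : ∀ j : V → ℤ, (if ∀ v ∈ D, j v = x v then ∏ e ∈ T, G e j else 0) ≤
        ∑' y : V → ℤ, (if ∀ w, (w ∉ A e ∨ w = v) → y w = x w then G e y else 0) *
          (if ∀ v ∈ D', j v = y v then ∏ e ∈ T.erase e, G e j else 0) := by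
      intro j
      split_ifs with hj
      · refine le_trans ?_ (ENNReal.le_tsum (D'.piecewise j x))
        have h1 : ∀ w, (w ∉ A e ∨ w = v) → D'.piecewise j x w = x w := by
          intro w hw
          by_cases hwD' : w ∈ D'
          · rw [Finset.piecewise_eq_of_mem _ _ _ hwD']
            rcases hw with hw | rfl
            · exact hj w ((Finset.mem_union.1 hwD').resolve_right hw)
            · exact hj w hv.2
          · rw [Finset.piecewise_eq_of_notMem _ _ _ hwD']
        have h2 : ∀ w ∈ D', j w = D'.piecewise j x w := fun w hw =>
          (Finset.piecewise_eq_of_mem _ _ _ hw).symm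
        rw [if_pos h1, if_pos h2, ← Finset.mul_prod_erase _ _ heT,
          hdep e j (D'.piecewise j x) fun w hw => h2 w (Finset.mem_union_right _ hw)]
      · exact zero_le
    have hlt : (Finset.univ \ D').card < N := by
      rw [← hN]
      refine Finset.card_lt_card ⟨Finset.sdiff_subset_sdiff subset_rfl Finset.subset_union_left, ?_⟩
      intro hsub
      obtain ⟨w, hw, hwD⟩ := Finset.not_subset.1 hnsub
      have := hsub (Finset.mem_sdiff.2 ⟨Finset.mem_univ w, hwD⟩)
      exact (Finset.mem_sdiff.1 this).2 (Finset.mem_union_right _ hw)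
    have hconn' : ∀ D'' : Finset V, D' ⊆ D'' → D'' ≠ Finset.univ →
        ∃ e' ∈ T.erase e, (A e' ∩ D'').Nonempty ∧ ¬ A e' ⊆ D'' := by
      intro D'' hsub hne'
      obtain ⟨e', he', h1, h2⟩ := hconn D'' (Finset.subset_union_left.trans hsub) hne'
      refine ⟨e', Finset.mem_erase.2 ⟨?_, he'⟩, h1, h2⟩
      rintro rfl
      exact h2 (Finset.subset_union_right.trans hsub)
    calc _ ≤ ∑' j : V → ℤ, ∑' y : V → ℤ,
          (if ∀ w, (w ∉ A e ∨ w = v) → y w = x w then G e y else 0) *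
          (if ∀ v ∈ D', j v = y v then ∏ e ∈ T.erase e, G e j else 0) := ENNReal.tsum_le_tsum hstep
      _ = ∑' y : V → ℤ, (if ∀ w, (w ∉ A e ∨ w = v) → y w = x w then G e y else 0) *
          ∑' j : V → ℤ, (if ∀ v ∈ D', j v = y v then ∏ e ∈ T.erase e, G e j else 0) := by
        rw [ENNReal.tsum_comm]
        exact tsum_congr fun y => ENNReal.tsum_mul_left
      _ ≤ ∑' y : V → ℤ, (if ∀ w, (w ∉ A e ∨ w = v) → y w = x w then G e y else 0) *
          ∏ e ∈ T.erase e, K e := by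
        refine ENNReal.tsum_le_tsum fun y => ?_
        gcongr
        exact ih _ hlt (T.erase e) (fun e he => hne e (Finset.mem_of_mem_erase he)) D' hconn' y rfl
      _ ≤ K e * ∏ e ∈ T.erase e, K e := by
        rw [ENNReal.tsum_mul_right]
        gcongr
        exact hK e v hv.1 x
      _ = _ := Finset.mul_prod_erase _ _ heT

/-- The possible restrictions to `D` of words with values in `[1, p]` whose values differ by at
most `M` (extended by zero outside `D`). -/
noncomputable def pinnedValues (p M : ℕ) (D : Finset V) (v₀ : V) : Finset (V → ℤ) :=
  (Finset.Icc (1 : ℤ) p).biUnion fun y => Fintype.piFinset fun v =>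
    if v = v₀ then {y} else if v ∈ D then Finset.Icc (y - M) (y + M) else {0}

theorem card_pinnedValues_le (p M : ℕ) {D : Finset V} {v₀ : V} (hv₀ : v₀ ∈ D) :
    (pinnedValues p M D v₀).card ≤ p * (2 * M + 1) ^ (D.card - 1) := by
  refine Finset.card_biUnion_le.trans ?_
  have h : ∀ y ∈ Finset.Icc (1 : ℤ) p, (Fintype.piFinset fun v =>
      if v = v₀ then {y} else if v ∈ D then Finset.Icc (y - M) (y + M) else {0}).card =
      (2 * M + 1) ^ (D.card - 1) := by
    intro y _
    rw [Fintype.card_piFinset, ← Finset.card_erase_of_mem hv₀, ← Finset.prod_const,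
      ← Finset.prod_subset (Finset.subset_univ (D.erase v₀))]
    · refine Finset.prod_congr rfl fun v hv => ?_
      rw [if_neg (Finset.ne_of_mem_erase hv), if_pos (Finset.mem_of_mem_erase hv), Int.card_Icc]
      omega
    · intro v _ hv
      by_cases hvv : v = v₀
      · simp [hvv]
      · rw [if_neg hvv, if_neg fun h => hv (Finset.mem_erase.2 ⟨hvv, h⟩), Finset.card_singleton]
  rw [Finset.sum_congr rfl h, Finset.sum_const, Int.card_Icc]
  simp

theorem exists_mem_pinnedValues {p M : ℕ} {D : Finset V} {v₀ : V} {j : V → ℤ}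
    (hv₀ : v₀ ∈ D) (hj : ∀ v, 1 ≤ j v ∧ j v ≤ p) (hM : ∀ v w, |j v - j w| ≤ M) :
    ∃ x ∈ pinnedValues p M D v₀, ∀ v ∈ D, j v = x v := by
  refine ⟨fun v => if v ∈ D then j v else 0, ?_, fun v hv => by simp [hv]⟩
  rw [pinnedValues, Finset.mem_biUnion]
  refine ⟨j v₀, Finset.mem_Icc.2 (hj v₀), Fintype.mem_piFinset.2 fun v => ?_⟩
  by_cases hvv : v = v₀
  · subst hvv
    simp [hv₀]
  · rw [if_neg hvv]
    split_ifs with hvD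
    · have := abs_le.1 (hM v v₀)
      rw [Finset.mem_Icc]
      omega
    · simp

/-- Summing over the positions of the pinned coordinates. -/
theorem sum_le_card_mul_of_pinned (F : (V → ℤ) → ℝ≥0∞) (D : Finset V) (K : ℝ≥0∞)
    (hF : ∀ x : V → ℤ, ∑' j : V → ℤ, (if ∀ v ∈ D, j v = x v then F j else 0) ≤ K)
    (X S : Finset (V → ℤ)) (hX : ∀ j ∈ S, ∃ x ∈ X, ∀ v ∈ D, j v = x v) :
    ∑ j ∈ S, F j ≤ X.card * K := by
  calc ∑ j ∈ S, F j ≤ ∑ j ∈ S, ∑ x ∈ X, (if ∀ v ∈ D, j v = x v then F j else 0) := by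
        refine Finset.sum_le_sum fun j hj => ?_
        obtain ⟨x, hx, hxj⟩ := hX j hj
        refine le_trans ?_ (Finset.single_le_sum (fun _ _ => zero_le) hx)
        rw [if_pos hxj]
    _ = ∑ x ∈ X, ∑ j ∈ S, (if ∀ v ∈ D, j v = x v then F j else 0) := Finset.sum_comm
    _ ≤ ∑ x ∈ X, K := Finset.sum_le_sum fun x _ => (ENNReal.sum_le_tsum S).trans (hF x)
    _ = X.card * K := by rw [Finset.sum_const, nsmul_eq_mul]

end Pinned

/-! ### Joint cumulants of a stationary sequence -/

section Stationary

variable {Ω : Type*} [MeasurableSpace Ω] {μ : Measure Ω} {Z : ℤ → Ω → ℝ}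
variable {ι V : Type*}

theorem IsStationary.integral_prod_shift (hZ : IsStationary μ Z) (A : Finset ι) (j : ι → ℤ)
    (c : ℤ) : ∫ ω, ∏ i ∈ A, Z (j i + c) ω ∂μ = ∫ ω, ∏ i ∈ A, Z (j i) ω ∂μ := by
  have hg : Measurable fun z : ℤ → ℝ => ∏ i ∈ A, z (j i) :=
    Finset.measurable_prod _ fun i _ => measurable_pi_apply _
  have h1 := integral_map (μ := μ) (φ := fun ω (j : ℤ) => Z (j + c) ω)
    (measurable_pi_lambda _ fun j => hZ.measurable _).aemeasurable
    (f := fun z : ℤ → ℝ => ∏ i ∈ A, z (j i)) hg.aestronglyMeasurable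
  have h2 := integral_map (μ := μ) (φ := fun ω (j : ℤ) => Z j ω)
    (measurable_pi_lambda _ fun j => hZ.measurable _).aemeasurable
    (f := fun z : ℤ → ℝ => ∏ i ∈ A, z (j i)) hg.aestronglyMeasurable
  rw [hZ.map_shift c] at h1
  exact h1.symm.trans h2

variable [DecidableEq ι]

theorem jointCumulant_eq_cumulantOf (X : ι → Ω → ℝ) (s : Finset ι) :
    jointCumulant μ X s = cumulantOf (fun A => ∫ ω, ∏ i ∈ A, X i ω ∂μ) s := rfl

theorem IsStationary.jointCumulant_shift (hZ : IsStationary μ Z) (s : Finset ι) (j : ι → ℤ)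
    (c : ℤ) :
    jointCumulant μ (fun i => Z (j i + c)) s = jointCumulant μ (fun i => Z (j i)) s := by
  rw [jointCumulant_eq_cumulantOf, jointCumulant_eq_cumulantOf]
  congr 1
  funext A
  exact hZ.integral_prod_shift A j c

theorem jointCumulant_map [IsProbabilityMeasure μ] {κ : Type*} [DecidableEq κ] (X : κ → Ω → ℝ)
    (f : ι ↪ κ) (s : Finset ι) (hs : s.Nonempty) :
    jointCumulant μ X (s.map f) = jointCumulant μ (fun i => X (f i)) s := by
  rw [jointCumulant_eq_cumulantOf, cumulantOf_map _ (by simp) f s hs, jointCumulant_eq_cumulantOf]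
  simp only [Finset.prod_map]

/-- The total mass of the joint cumulants of order `r + 1` with one argument fixed at `0`. -/
noncomputable def cumulantMass (μ : Measure Ω) (Z : ℤ → Ω → ℝ) (r : ℕ) : ℝ≥0∞ :=
  ∑' d : Fin r → ℤ, ENNReal.ofReal |jointCumulant μ
    (fun i : Fin (r + 1) => Z ((Fin.cons 0 d : Fin (r + 1) → ℤ) i)) Finset.univ|

theorem CumulantSummable.cumulantMass_ne_top (h : CumulantSummable μ Z) {r : ℕ} (hr : 1 ≤ r) :
    cumulantMass μ Z r ≠ ∞ := by
  have h1 := (h.summable r hr).tsum_ofReal_ne_top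
  exact h1

theorem tsum_jointCumulant_pinned_le [IsProbabilityMeasure μ] [Fintype V] [DecidableEq V]
    (hZ : IsStationary μ Z) (ν : ι → V) (A : Finset ι) {a₀ : ι} (ha₀ : a₀ ∈ A) (x : V → ℤ) :
    ∑' j : V → ℤ, (if ∀ w, (w ∉ A.image ν ∨ w = ν a₀) → j w = x w then
      ENNReal.ofReal |jointCumulant μ (fun a => Z (j (ν a))) A| else 0) ≤
      cumulantMass μ Z (A.card - 1) := by
  classical
  obtain ⟨r, hr⟩ : ∃ r, A.card = r + 1 :=
    ⟨A.card - 1, (Nat.sub_add_cancel (Finset.card_pos.2 ⟨a₀, ha₀⟩)).symm⟩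
  rw [hr, Nat.add_sub_cancel]
  obtain ⟨e, he⟩ : ∃ e : Fin (r + 1) ≃ A, e 0 = ⟨a₀, ha₀⟩ :=
    ⟨(A.equivFinOfCardEq hr).symm.trans
      (Equiv.swap ((A.equivFinOfCardEq hr).symm 0) ⟨a₀, ha₀⟩), by simp⟩
  let f : Fin (r + 1) ↪ ι := ⟨fun i => e i, fun i i' h => e.injective (Subtype.ext h)⟩
  have hf0 : f 0 = a₀ := congrArg Subtype.val he
  have hmap : (Finset.univ : Finset (Fin (r + 1))).map f = A := by
    ext a
    simp only [Finset.mem_map, Finset.mem_univ, true_and]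
    constructor
    · rintro ⟨i, rfl⟩
      exact (e i).2
    · intro ha
      exact ⟨e.symm ⟨a, ha⟩, congrArg Subtype.val (e.apply_symm_apply ⟨a, ha⟩)⟩
  -- `d j` lists the increments of the word `j` relative to the pinned letter
  let d : (V → ℤ) → Fin r → ℤ := fun j i => j (ν (f i.succ)) - j (ν a₀)
  have hval : ∀ j : V → ℤ, jointCumulant μ (fun a => Z (j (ν a))) A = jointCumulant μ
      (fun i : Fin (r + 1) => Z ((Fin.cons 0 (d j) : Fin (r + 1) → ℤ) i)) Finset.univ := by
    intro j
    rw [← hmap, jointCumulant_map _ f _ Finset.univ_nonempty,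
      ← hZ.jointCumulant_shift Finset.univ (fun i => j (ν (f i))) (-j (ν a₀))]
    congr 1
    funext i
    congr 1
    refine Fin.cases ?_ (fun i => ?_) i
    · simp [hf0]
    · simp [d, sub_eq_add_neg]
  let S : Set (V → ℤ) := {j | ∀ w, (w ∉ A.image ν ∨ w = ν a₀) → j w = x w}
  have hinj : Function.Injective fun j : S => d j := by
    rintro ⟨j, hj⟩ ⟨j', hj'⟩ h
    refine Subtype.ext (funext fun w => ?_)
    have hpin : j (ν a₀) = j' (ν a₀) := (hj _ (Or.inr rfl)).trans (hj' _ (Or.inr rfl)).symm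
    by_cases hw : w ∈ A.image ν
    · obtain ⟨a, ha, rfl⟩ := Finset.mem_image.1 hw
      rw [← hmap] at ha
      obtain ⟨i, -, rfl⟩ := Finset.mem_map.1 ha
      revert hw ha
      refine Fin.cases ?_ (fun i => ?_) i
      · intro _ _
        rw [hf0]
        exact hpin
      · intro _ _
        have := congrFun h i
        simp only [d] at this
        change j (ν (f i.succ)) = j' (ν (f i.succ))
        linarith
    · exact (hj w (Or.inl hw)).trans (hj' w (Or.inl hw)).symm
  calc _ = ∑' j : S, ENNReal.ofReal |jointCumulant μ (fun a => Z ((j : V → ℤ) (ν a))) A| := by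
        rw [tsum_subtype S fun j : V → ℤ =>
          ENNReal.ofReal |jointCumulant μ (fun a => Z (j (ν a))) A|]
        refine tsum_congr fun j => ?_
        by_cases hj : ∀ w, (w ∉ A.image ν ∨ w = ν a₀) → j w = x w
        · rw [Set.indicator_of_mem (s := S) hj, if_pos hj]
        · rw [Set.indicator_of_notMem (s := S) hj, if_neg hj]
    _ = ∑' j : S, ENNReal.ofReal |jointCumulant μ
          (fun i : Fin (r + 1) => Z ((Fin.cons 0 (d j) : Fin (r + 1) → ℤ) i)) Finset.univ| := by
        refine tsum_congr fun j => ?_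
        rw [hval]
    _ ≤ cumulantMass μ Z r := ENNReal.tsum_comp_le_tsum_of_injective hinj
        fun d : Fin r → ℤ => ENNReal.ofReal |jointCumulant μ
          (fun i : Fin (r + 1) => Z ((Fin.cons 0 d : Fin (r + 1) → ℤ) i)) Finset.univ|

end Stationary

/-! ### Partitions of the positions of a cyclic word -/

section Partitions

variable {k : ℕ}

/-- The letter of a cyclic word `i : Fin k → α` read at a position: the words on the positions that
are constant on the blocks of `Π₁` are the functions `i ∘ letter`. -/
def letter (a : Pos k) : Fin k := if a.2 = true then finRotate k a.1 else a.1

@[simp] theorem letter_false (t : Fin k) : letter (t, false) = t := rfl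

@[simp] theorem letter_true (t : Fin k) : letter (t, true) = finRotate k t := rfl

theorem matching0_part_eq_iff (a a' : Pos k) :
    (matching0 k).part a = (matching0 k).part a' ↔ a.1 = a'.1 := by
  classical
  rw [← Finpartition.mem_part_iff_part_eq_part _ (Finset.mem_univ a) (Finset.mem_univ a'),
    matching0, Finpartition.mem_part_ofSetoid_iff_rel, Setoid.ker_def, eq_comm]

theorem matching1_part_eq_iff (a a' : Pos k) :
    (matching1 k).part a = (matching1 k).part a' ↔ letter a = letter a' := by
  classical
  rw [← Finpartition.mem_part_iff_part_eq_part _ (Finset.mem_univ a) (Finset.mem_univ a'),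
    matching1, Finpartition.mem_part_ofSetoid_iff_rel, Setoid.ker_def, eq_comm]
  rfl

theorem part_eq_iff_exists (P : Part k) (a a' : Pos k) :
    P.part a = P.part a' ↔ ∃ A ∈ P.parts, a ∈ A ∧ a' ∈ A := by
  rw [← Finpartition.mem_part_iff_part_eq_part _ (Finset.mem_univ a) (Finset.mem_univ a'),
    Finpartition.mem_part_iff_exists]

theorem ker_part_le_ker_iff {β : Type*} (P : Part k) (j : Pos k → β) :
    Setoid.ker P.part ≤ Setoid.ker j ↔ IsMeas P j := by
  constructor
  · intro h A hA a ha a' ha'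
    exact h ((part_eq_iff_exists P a a').2 ⟨A, hA, ha, ha'⟩)
  · intro h a a' haa'
    obtain ⟨A, hA, ha, ha'⟩ := (part_eq_iff_exists P a a').1 haa'
    exact h A hA a ha a' ha'

theorem isMeas_matching0_iff {β : Type*} (j : Pos k → β) :
    IsMeas (matching0 k) j ↔ ∃ r : Fin k → β, j = fun a => r a.1 := by
  rw [← ker_part_le_ker_iff]
  constructor
  · intro h
    refine ⟨fun t => j (t, false), funext fun a => ?_⟩
    exact h ((matching0_part_eq_iff a (a.1, false)).2 rfl)
  · rintro ⟨r, rfl⟩ a a' haa'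
    exact congrArg r ((matching0_part_eq_iff a a').1 haa')

theorem isMeas_matching1_iff {β : Type*} (j : Pos k → β) :
    IsMeas (matching1 k) j ↔ ∃ i : Fin k → β, j = fun a => i (letter a) := by
  rw [← ker_part_le_ker_iff]
  constructor
  · intro h
    refine ⟨fun t => j (t, false), funext fun a => ?_⟩
    exact h ((matching1_part_eq_iff a (letter a, false)).2 rfl)
  · rintro ⟨r, rfl⟩ a a' haa'
    exact congrArg r ((matching1_part_eq_iff a a').1 haa')

theorem mem_part2_iff (P : Part k) : P ∈ part2 k ↔ ∀ A ∈ P.parts, 2 ≤ A.card := by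
  simp [part2]

theorem card_parts_le_of_mem_part2 {P : Part k} (hP : P ∈ part2 k) : P.parts.card ≤ k := by
  have h1 := P.sum_card_parts
  have h2 : ∑ _A ∈ P.parts, 2 ≤ ∑ A ∈ P.parts, A.card :=
    Finset.sum_le_sum fun A hA => (mem_part2_iff P).1 hP A hA
  rw [h1, Finset.sum_const, Finset.card_univ] at h2
  simp only [smul_eq_mul, Fintype.card_prod, Fintype.card_fin, Fintype.card_bool] at h2
  omega

/-- A function on `ℤ / k` that varies by at most `b` along each step varies by at most `2kb`. -/
theorem abs_sub_le_of_finRotate (u : Fin k → ℝ) (b : ℝ)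
    (h : ∀ t, |u t - u (finRotate k t)| ≤ b) (s t : Fin k) : |u s - u t| ≤ 2 * k * b := by
  obtain _ | m := k
  · exact s.elim0
  have hb : 0 ≤ b := (abs_nonneg _).trans (h 0)
  have key : ∀ t : Fin (m + 1), |u 0 - u t| ≤ (t : ℕ) * b := by
    intro t
    induction t using Fin.induction with
    | zero => simp
    | succ i ih =>
      have h1 := h i.castSucc
      rw [finRotate_apply, Fin.coeSucc_eq_succ] at h1
      have h2 := abs_sub_le (u 0) (u i.castSucc) (u i.succ)
      rw [Fin.val_castSucc] at ih
      rw [Fin.val_succ]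
      push_cast
      linarith
  have h1 := key s
  have h2 := key t
  have hs : ((s : ℕ) : ℝ) * b ≤ ((m + 1 : ℕ) : ℝ) * b :=
    mul_le_mul_of_nonneg_right (by exact_mod_cast s.2.le) hb
  have ht : ((t : ℕ) : ℝ) * b ≤ ((m + 1 : ℕ) : ℝ) * b :=
    mul_le_mul_of_nonneg_right (by exact_mod_cast t.2.le) hb
  have h3 := abs_sub_le (u s) (u 0) (u t)
  rw [abs_sub_comm (u s) (u 0)] at h3
  linarith

theorem eq_of_finRotate_invariant (u : Fin k → ℝ) (h : ∀ t, u (finRotate k t) = u t)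
    (s t : Fin k) : u s = u t := by
  have h1 := abs_sub_le_of_finRotate u 0 (fun t => by rw [h t]; simp) s t
  rw [mul_zero] at h1
  exact sub_eq_zero.1 (abs_nonpos_iff.1 h1)

/-- The equivalence relation of the join of two partitions. -/
def joinSetoid (P Q : Part k) : Setoid (Pos k) := Setoid.ker P.part ⊔ Setoid.ker Q.part

theorem cardJoin_eq (P Q : Part k) : cardJoin P Q = Nat.card (Quotient (joinSetoid P Q)) := rfl

theorem joinSetoid_le_ker_iff {β : Type*} (P Q : Part k) (j : Pos k → β) :
    joinSetoid P Q ≤ Setoid.ker j ↔ IsMeas P j ∧ IsMeas Q j := by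
  rw [joinSetoid, sup_le_iff, ker_part_le_ker_iff, ker_part_le_ker_iff]

theorem mk_eq_of_left {P Q : Part k} {a a' : Pos k} (h : P.part a = P.part a') :
    (Quotient.mk (joinSetoid P Q) a) = Quotient.mk _ a' :=
  Quotient.sound ((le_sup_left : Setoid.ker P.part ≤ joinSetoid P Q) h)

theorem mk_eq_of_right {P Q : Part k} {a a' : Pos k} (h : Q.part a = Q.part a') :
    (Quotient.mk (joinSetoid P Q) a) = Quotient.mk _ a' :=
  Quotient.sound ((le_sup_right : Setoid.ker Q.part ≤ joinSetoid P Q) h)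

/-- The linear map sending functions `f`, `g` on the blocks of the joins `Π₀ ∨ P` and `Π₁ ∨ P` to
`f + g`, as a function on the blocks of `P` (evaluated at a chosen element of each block). -/
noncomputable def joinSum (P : Part k) :
    ((Quotient (joinSetoid (matching0 k) P) → ℝ) × (Quotient (joinSetoid (matching1 k) P) → ℝ))
      →ₗ[ℝ] (P.parts → ℝ) where
  toFun f A := f.1 (Quotient.mk _ (P.nonempty_of_mem_parts A.2).choose) +
    f.2 (Quotient.mk _ (P.nonempty_of_mem_parts A.2).choose)
  map_add' f g := by
    funext A
    simp only [Prod.fst_add, Prod.snd_add, Pi.add_apply]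
    ring
  map_smul' c f := by
    funext A
    simp only [Prod.smul_fst, Prod.smul_snd, Pi.smul_apply, RingHom.id_apply, smul_add]

/-- If `f + g = 0`, then the common function `f = -g` on positions is constant on the blocks of both
`Π₀` and `Π₁`, hence constant along the whole cycle. -/
theorem exists_const_of_joinSum_eq_zero (P : Part k) (hk : 0 < k)
    {f : (Quotient (joinSetoid (matching0 k) P) → ℝ) ×
      (Quotient (joinSetoid (matching1 k) P) → ℝ)} (hf : joinSum P f = 0) :
    ∃ c : ℝ, f = (fun _ => c, fun _ => -c) := by
  have hsum : ∀ a : Pos k, f.1 (Quotient.mk _ a) + f.2 (Quotient.mk _ a) = 0 := by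
    intro a
    have hA := P.part_mem.2 (Finset.mem_univ a)
    have h := congrFun hf ⟨P.part a, hA⟩
    have hrep := (P.nonempty_of_mem_parts hA).choose_spec
    have heq : P.part a = P.part (P.nonempty_of_mem_parts hA).choose :=
      (part_eq_iff_exists _ _ _).2 ⟨_, hA, P.mem_part_self.2 (Finset.mem_univ a), hrep⟩
    rw [mk_eq_of_right heq, mk_eq_of_right heq]
    exact h
  have h0 : ∀ t : Fin k, f.1 (Quotient.mk _ (t, true)) = f.1 (Quotient.mk _ (t, false)) :=
    fun t => congrArg f.1 (mk_eq_of_left ((matching0_part_eq_iff _ _).2 rfl))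
  have h1 : ∀ t : Fin k, f.2 (Quotient.mk _ (t, true)) =
      f.2 (Quotient.mk _ (finRotate k t, false)) :=
    fun t => congrArg f.2 (mk_eq_of_left ((matching1_part_eq_iff _ _).2 rfl))
  have hrot : ∀ t : Fin k, f.1 (Quotient.mk _ (finRotate k t, false)) =
      f.1 (Quotient.mk _ (t, false)) := by
    intro t
    have e1 := hsum (t, true)
    have e2 := hsum (finRotate k t, false)
    rw [h0, h1] at e1
    linarith
  have hconst : ∀ a : Pos k, f.1 (Quotient.mk _ a) = f.1 (Quotient.mk _ (⟨0, hk⟩, false)) := by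
    rintro ⟨t, b⟩
    have := eq_of_finRotate_invariant (fun t => f.1 (Quotient.mk _ (t, false))) hrot t ⟨0, hk⟩
    cases b
    · exact this
    · exact (h0 t).trans this
  refine ⟨f.1 (Quotient.mk _ (⟨0, hk⟩, false)), Prod.ext (funext fun q => ?_) (funext fun q => ?_)⟩
  · induction q using Quotient.inductionOn with
    | h a => exact hconst a
  · induction q using Quotient.inductionOn with
    | h a =>
      have e1 := hsum a
      rw [hconst a] at e1
      change f.2 _ = -_
      linarith

/-- The combinatorial inequality behind the asymptotics. It is the dimension count for two
subspaces of the functions on the blocks of `P`: the functions constant on the blocks of `Π₀ ∨ P`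
and those constant on the blocks of `Π₁ ∨ P` meet only in the constants. -/
theorem cardJoin_add_cardJoin_le {P : Part k} (hP : P ∈ part2 k) (hk : 0 < k) :
    cardJoin (matching0 k) P + cardJoin (matching1 k) P ≤ k + 1 := by
  classical
  have hker : Module.finrank ℝ (LinearMap.ker (joinSum P)) ≤ 1 := by
    refine finrank_le_one
      (⟨(fun _ => 1, fun _ => -1), by
        rw [LinearMap.mem_ker]
        funext A
        simp [joinSum]⟩ : LinearMap.ker (joinSum P)) fun w => ?_
    obtain ⟨c, hc⟩ := exists_const_of_joinSum_eq_zero P hk (LinearMap.mem_ker.1 w.2)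
    refine ⟨c, Subtype.ext ?_⟩
    rw [hc]
    refine Prod.ext (funext fun q => ?_) (funext fun q => ?_) <;> simp
  have hrange : Module.finrank ℝ (LinearMap.range (joinSum P)) ≤ P.parts.card := by
    refine (Submodule.finrank_le _).trans_eq ?_
    rw [Module.finrank_fintype_fun_eq_card, Fintype.card_coe]
  have hsum := (joinSum P).finrank_range_add_finrank_ker
  rw [Module.finrank_prod, Module.finrank_fintype_fun_eq_card,
    Module.finrank_fintype_fun_eq_card, ← Nat.card_eq_fintype_card,
    ← Nat.card_eq_fintype_card, ← cardJoin_eq, ← cardJoin_eq] at hsum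
  have := card_parts_le_of_mem_part2 hP
  omega

theorem cardJoin_pos (P Q : Part k) (hk : 0 < k) : 0 < cardJoin P Q := by
  have : Nonempty (Quotient (joinSetoid P Q)) := ⟨Quotient.mk _ (⟨0, hk⟩, false)⟩
  rw [cardJoin_eq]
  exact Nat.card_pos

theorem surjective_mk_false (P : Part k) : Function.Surjective
    fun t : Fin k => (Quotient.mk (joinSetoid (matching0 k) P) (t, false)) := by
  intro q
  induction q using Quotient.inductionOn with
  | h a => exact ⟨a.1, mk_eq_of_left ((matching0_part_eq_iff _ _).2 rfl)⟩

theorem matching0_mem_part2 : matching0 k ∈ part2 k := by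
  rw [mem_part2_iff]
  intro A hA
  obtain ⟨a, ha⟩ := (matching0 k).nonempty_of_mem_parts hA
  have hmem : ∀ c : Bool, (a.1, c) ∈ A := by
    intro c
    rw [← (matching0 k).part_eq_of_mem hA ha,
      Finpartition.mem_part_iff_part_eq_part _ (Finset.mem_univ _) (Finset.mem_univ _),
      matching0_part_eq_iff]
  exact Finset.one_lt_card.2 ⟨(a.1, false), hmem _, (a.1, true), hmem _, by simp⟩

theorem cardJoin_matching0_self : cardJoin (matching0 k) (matching0 k) = k := by
  rw [cardJoin_eq]
  have hinj : Function.Injective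
      fun t : Fin k => (Quotient.mk (joinSetoid (matching0 k) (matching0 k)) (t, false)) := by
    intro t t' h
    have := (joinSetoid_le_ker_iff (matching0 k) (matching0 k) Prod.fst).2
      ⟨(isMeas_matching0_iff _).2 ⟨id, rfl⟩, (isMeas_matching0_iff _).2 ⟨id, rfl⟩⟩
    exact this (Quotient.exact h)
  rw [← Nat.card_congr (Equiv.ofBijective _ ⟨hinj, surjective_mk_false (matching0 k)⟩)]
  simp

theorem part_eq_pair {P : Part k} (hP : P ∈ part2 k)
    (hle : ∀ a a' : Pos k, P.part a = P.part a' → a.1 = a'.1) (a : Pos k) :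
    P.part a = {(a.1, false), (a.1, true)} := by
  have hA := P.part_mem.2 (Finset.mem_univ a)
  refine Finset.eq_of_subset_of_card_le (fun c hc => ?_) ?_
  · obtain ⟨t, e⟩ := c
    obtain rfl : t = a.1 := hle (t, e) a
      ((P.mem_part_iff_part_eq_part (Finset.mem_univ _) (Finset.mem_univ a)).1 hc)
    cases e <;> simp
  · exact Finset.card_le_two.trans ((mem_part2_iff P).1 hP _ hA)

theorem matching0_part_eq_pair (a : Pos k) :
    (matching0 k).part a = {(a.1, false), (a.1, true)} :=
  part_eq_pair matching0_mem_part2 (fun a a' => (matching0_part_eq_iff a a').1) a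

theorem prod_matching0_parts (F : Finset (Pos k) → ℝ) :
    ∏ A ∈ (matching0 k).parts, F A = ∏ t : Fin k, F {(t, false), (t, true)} := by
  symm
  refine Finset.prod_bij (fun t _ => {(t, false), (t, true)}) ?_ ?_ ?_ ?_
  · intro t _
    rw [← matching0_part_eq_pair (t, false)]
    exact (matching0 k).part_mem.2 (Finset.mem_univ _)
  · intro t _ t' _ h
    have : (t, false) ∈ ({(t', false), (t', true)} : Finset (Pos k)) := by
      rw [← h]
      simp
    simpa using this
  · intro A hA
    obtain ⟨a, ha⟩ := (matching0 k).nonempty_of_mem_parts hA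
    exact ⟨a.1, Finset.mem_univ _, by
      rw [← matching0_part_eq_pair a, (matching0 k).part_eq_of_mem hA ha]⟩
  · intro t _
    rfl

/-- Rigidity: a partition without singletons that does not reduce the number of blocks of `Π₀` is
`Π₀` itself. -/
theorem eq_matching0_of_cardJoin_eq {P : Part k} (hP : P ∈ part2 k)
    (h : cardJoin (matching0 k) P = k) : P = matching0 k := by
  classical
  have hbij := (surjective_mk_false P).bijective_of_nat_card_le (by
    rw [← cardJoin_eq, h]
    simp)
  have hle : ∀ a a' : Pos k, P.part a = P.part a' → a.1 = a'.1 := by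
    intro a a' haa'
    apply hbij.1
    have e1 : (Quotient.mk (joinSetoid (matching0 k) P) (a.1, false)) = Quotient.mk _ a :=
      mk_eq_of_left ((matching0_part_eq_iff _ _).2 rfl)
    have e2 : (Quotient.mk (joinSetoid (matching0 k) P) (a'.1, false)) = Quotient.mk _ a' :=
      mk_eq_of_left ((matching0_part_eq_iff _ _).2 rfl)
    exact e1.trans ((mk_eq_of_right haa').trans e2.symm)
  have hpart : ∀ a, P.part a = (matching0 k).part a := fun a =>
    (part_eq_pair hP hle a).trans
      (matching0_part_eq_pair a).symm
  have hparts : ∀ (Q : Part k) (A : Finset (Pos k)), A ∈ Q.parts ↔ ∃ a, Q.part a = A := by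
    intro Q A
    constructor
    · intro hA
      obtain ⟨a, ha⟩ := Q.nonempty_of_mem_parts hA
      exact ⟨a, Q.part_eq_of_mem hA ha⟩
    · rintro ⟨a, rfl⟩
      exact Q.part_mem.2 (Finset.mem_univ a)
  apply Finpartition.ext
  ext A
  simp only [hparts, hpart]

/-- One letter for each block of `Π₁ ∨ P`. -/
noncomputable def representatives (P : Part k) : Finset (Fin k) := by
  classical
  exact Finset.univ.image fun q : Quotient (joinSetoid (matching1 k) P) => letter q.out

theorem card_representatives_le (P : Part k) :
    (representatives P).card ≤ cardJoin (matching1 k) P := by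
  classical
  rw [cardJoin_eq, Nat.card_eq_fintype_card, ← Finset.card_univ]
  unfold representatives
  exact Finset.card_image_le

theorem representatives_nonempty (P : Part k) (hk : 0 < k) : (representatives P).Nonempty := by
  classical
  unfold representatives
  refine Finset.Nonempty.image ?_ _
  exact ⟨Quotient.mk _ (⟨0, hk⟩, false), Finset.mem_univ _⟩

/-- Every letter is linked to the chosen representatives through blocks of `P`. -/
theorem exists_part_of_representatives_subset (P : Part k) (D : Finset (Fin k))
    (hD : representatives P ⊆ D) (hne : D ≠ Finset.univ) :
    ∃ A ∈ P.parts, (A.image letter ∩ D).Nonempty ∧ ¬ A.image letter ⊆ D := by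
  classical
  by_contra! hcon
  apply hne
  have h1 : IsMeas (matching1 k) fun a : Pos k => letter a ∈ D :=
    (isMeas_matching1_iff _).2 ⟨fun v => v ∈ D, rfl⟩
  have h2 : IsMeas P fun a : Pos k => letter a ∈ D := by
    have key : ∀ A ∈ P.parts, ∀ a ∈ A, ∀ a' ∈ A, letter a ∈ D → letter a' ∈ D := by
      intro A hA a ha a' ha' haD
      exact hcon A hA ⟨letter a, Finset.mem_inter.2 ⟨Finset.mem_image_of_mem _ ha, haD⟩⟩
        (Finset.mem_image_of_mem _ ha')
    intro A hA a ha a' ha'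
    exact propext ⟨key A hA a ha a' ha', key A hA a' ha' a ha⟩
  have h3 := (joinSetoid_le_ker_iff (matching1 k) P _).2 ⟨h1, h2⟩
  refine Finset.eq_univ_of_forall fun v => ?_
  have h4 : (letter (Quotient.mk (joinSetoid (matching1 k) P) (v, false)).out ∈ D) =
      (letter (v, false) ∈ D) := h3 (Quotient.mk_out (v, false))
  rw [letter_false] at h4
  rw [← h4]
  apply hD
  unfold representatives
  exact Finset.mem_image_of_mem _ (Finset.mem_univ _)

end Partitions

/-! ### Contributions of partitions and their limits -/

section Covariance

variable {Ω : Type*} [MeasurableSpace Ω] {μ : Measure Ω} {Z : ℤ → Ω → ℝ}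

theorem integral_eq_zero (hZ : IsStationary μ Z) (hcum : CumulantSummable μ Z) (j : ℤ) :
    ∫ ω, Z j ω ∂μ = 0 := by
  have h := hZ.integral_prod_shift (Finset.univ : Finset Unit) (fun _ => 0) j
  simpa [hcum.mean_zero] using h

theorem integral_mul_eq_autocov (hZ : IsStationary μ Z) (hcum : CumulantSummable μ Z) (i j : ℤ) :
    ∫ ω, Z i ω * Z j ω ∂μ = autocov μ Z (j - i) := by
  have h := hZ.integral_prod_shift (Finset.univ : Finset Bool)
    (fun c => if c = true then 0 else j - i) i
  simp only [Fintype.prod_bool, if_true, zero_add, Bool.false_eq_true, if_false,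
    sub_add_cancel] at h
  rw [h, autocov, covariance]
  simp [integral_eq_zero hZ hcum]

theorem autocov_neg (hZ : IsStationary μ Z) (hcum : CumulantSummable μ Z) (j : ℤ) :
    autocov μ Z (-j) = autocov μ Z j := by
  have h1 := integral_mul_eq_autocov hZ hcum j 0
  have h2 := integral_mul_eq_autocov hZ hcum 0 j
  simp only [zero_sub, sub_zero] at h1 h2
  rw [← h1, ← h2]
  simp only [mul_comm]

theorem jointCumulant_singleton [IsProbabilityMeasure μ] {ι : Type*} [DecidableEq ι]
    (X : ι → Ω → ℝ) (a : ι) : jointCumulant μ X {a} = ∫ ω, X a ω ∂μ := by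
  rw [jointCumulant_eq_cumulantOf, cumulantOf_singleton _ (by simp)]
  simp

theorem jointCumulant_pair [IsProbabilityMeasure μ] (hZ : IsStationary μ Z)
    (hcum : CumulantSummable μ Z) {ι : Type*} [DecidableEq ι] (j : ι → ℤ) {a b : ι} (hab : a ≠ b) :
    jointCumulant μ (fun i => Z (j i)) {a, b} = autocov μ Z (j b - j a) := by
  rw [jointCumulant_eq_cumulantOf, cumulantOf_pair _ (by simp) hab]
  · simp only [Finset.prod_pair hab]
    exact integral_mul_eq_autocov hZ hcum _ _
  · simp [integral_eq_zero hZ hcum]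

theorem summable_autocov [IsProbabilityMeasure μ] (hZ : IsStationary μ Z)
    (hcum : CumulantSummable μ Z) : Summable (autocov μ Z) := by
  have h := hcum.summable 1 le_rfl
  have h2 : (fun d : Fin 1 → ℤ => |jointCumulant μ
      (fun i : Fin (1 + 1) => Z ((Fin.cons 0 d : Fin (1 + 1) → ℤ) i)) Finset.univ|) =
      (fun j => |autocov μ Z j|) ∘ Equiv.funUnique (Fin 1) ℤ := by
    funext d
    have hu : (Finset.univ : Finset (Fin (1 + 1))) = {0, 1} := rfl
    rw [hu, jointCumulant_pair hZ hcum _ (by decide)]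
    simp
  rw [h2, Equiv.summable_iff] at h
  exact h.of_abs

end Covariance

section Contribution

variable {Ω : Type*} [MeasurableSpace Ω] {μ : Measure Ω} {Z : ℤ → Ω → ℝ} {k : ℕ}

/-- The cyclic word with letters in `{1, …, p}` attached to `i : Fin k → Fin p`. -/
def word {p : ℕ} (i : Fin k → Fin p) (v : Fin k) : ℤ := (i v : ℤ) + 1

/-- The product `∏ B` of the entries of the banding matrix along a cyclic word. -/
noncomputable def bandProd (b : ℝ) {p : ℕ} (i : Fin k → Fin p) : ℝ :=
  ∏ t : Fin k, bandMatrix b p (i t) (i (finRotate k t))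

theorem bandProd_eq (b : ℝ) {p : ℕ} (i : Fin k → Fin p) :
    bandProd b i = if ∀ t, |((i t : ℕ) : ℝ) - (i (finRotate k t) : ℕ)| ≤ b then 1 else 0 := by
  simp only [bandProd, bandMatrix_apply, Finset.prod_boole, Finset.mem_univ, true_implies]

theorem contribution_eq (b : ℝ) (n p : ℕ) (P : Part k) :
    contribution μ Z b n p P =
      (p : ℝ)⁻¹ * (n : ℝ) ^ (-(k : ℤ) + (cardJoin (matching0 k) P : ℤ)) *
        ∑ i : Fin k → Fin p, bandProd b i * cumulantProd μ Z P fun a => word i (letter a) := by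
  classical
  unfold contribution
  congr 1
  symm
  refine Finset.sum_bij (fun i _ a => i (letter a)) ?_ ?_ ?_ ?_
  · intro i _
    exact Finset.mem_filter.2 ⟨Finset.mem_univ _, (isMeas_matching1_iff _).2 ⟨i, rfl⟩⟩
  · intro i _ i' _ h
    exact funext fun t => congrFun h (t, false)
  · intro j hj
    obtain ⟨i, hi⟩ := (isMeas_matching1_iff j).1 (Finset.mem_filter.1 hj).2
    exact ⟨i, Finset.mem_univ _, hi.symm⟩
  · intro i _
    rfl

variable [IsProbabilityMeasure μ]

theorem cumulantProd_eq_zero (hZ : IsStationary μ Z) (hcum : CumulantSummable μ Z) {P : Part k}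
    (hP : P ∉ part2 k) (j : Pos k → ℤ) : cumulantProd μ Z P j = 0 := by
  rw [mem_part2_iff] at hP
  push Not at hP
  obtain ⟨A, hA, hcard⟩ := hP
  have h1 := (P.nonempty_of_mem_parts hA).card_pos
  obtain ⟨a, rfl⟩ := Finset.card_eq_one.1 (show A.card = 1 by omega)
  refine Finset.prod_eq_zero hA ?_
  rw [jointCumulant_singleton]
  exact integral_eq_zero hZ hcum _

theorem contribution_matching0 (hZ : IsStationary μ Z) (hcum : CumulantSummable μ Z) (hk : 0 < k)
    (b : ℝ) (n p : ℕ) :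
    contribution μ Z b n p (matching0 k) =
      (p : ℝ)⁻¹ * (toeplitz (autocov μ Z) b p ^ k).trace := by
  rw [contribution_eq, cardJoin_matching0_self, neg_add_cancel, zpow_zero, mul_one,
    trace_pow_eq_sum_cyclic _ hk]
  congr 1
  refine Finset.sum_congr rfl fun i _ => ?_
  rw [bandProd, cumulantProd, prod_matching0_parts, ← Finset.prod_mul_distrib]
  refine Finset.prod_congr rfl fun t _ => ?_
  rw [jointCumulant_pair hZ hcum _ (by simp), toeplitz, Matrix.of_apply]
  simp [word]

/-- Pinning one letter per block of `Π₁ ∨ P` bounds the sum over the remaining letters by the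
cumulant masses; the pinned letters are within `2kb` of each other. -/
theorem exists_sum_band_cumulant_le (hZ : IsStationary μ Z) (hcum : CumulantSummable μ Z)
    (hk : 0 < k) {P : Part k} (hP : P ∈ part2 k) :
    ∃ K : ℝ, 0 ≤ K ∧ ∀ (b : ℝ) (p : ℕ), 0 ≤ b →
      ∑ i : Fin k → Fin p, bandProd b i * |cumulantProd μ Z P fun a => word i (letter a)| ≤
        p * (2 * (2 * k * b) + 1) ^ (cardJoin (matching1 k) P - 1) * K := by
  classical
  set G : Finset (Pos k) → (Fin k → ℤ) → ℝ≥0∞ := fun A j =>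
    ENNReal.ofReal |jointCumulant μ (fun a => Z (j (letter a))) A| with hG
  set KE : ℝ≥0∞ := ∏ A ∈ P.parts, cumulantMass μ Z (A.card - 1) with hKE
  have hKE_top : KE ≠ ∞ := ENNReal.prod_ne_top fun A hA =>
    hcum.cumulantMass_ne_top (Nat.le_sub_one_of_lt ((mem_part2_iff P).1 hP A hA))
  have hdep : ∀ (A : Finset (Pos k)) (j j' : Fin k → ℤ), (∀ v ∈ A.image letter, j v = j' v) →
      G A j = G A j' := by
    intro A j j' h
    have hm : ∀ B ⊆ A, ∫ ω, ∏ a ∈ B, Z (j (letter a)) ω ∂μ =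
        ∫ ω, ∏ a ∈ B, Z (j' (letter a)) ω ∂μ := by
      intro B hB
      refine integral_congr_ae (.of_forall fun ω => Finset.prod_congr rfl fun a ha => ?_)
      rw [h _ (Finset.mem_image_of_mem _ (hB ha))]
    have : jointCumulant μ (fun a => Z (j (letter a))) A =
        jointCumulant μ (fun a => Z (j' (letter a))) A := by
      unfold jointCumulant
      refine Finset.sum_congr rfl fun Q _ => ?_
      congr 1
      exact Finset.prod_congr rfl fun B hB => hm B (Q.subset hB)
    simp only [hG, this]
  have hF := tsum_pinned_le G (fun A => A.image letter) (fun A => cumulantMass μ Z (A.card - 1))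
    hdep
    (fun A v hv x => by
      obtain ⟨a, ha, rfl⟩ := Finset.mem_image.1 hv
      exact tsum_jointCumulant_pinned_le hZ letter A ha x)
    P.parts (fun A hA => (P.nonempty_of_mem_parts hA).image _) (representatives P)
    (exists_part_of_representatives_subset P)
  refine ⟨KE.toReal, ENNReal.toReal_nonneg, fun b p hb => ?_⟩
  obtain ⟨v₀, hv₀⟩ := representatives_nonempty P hk
  set M : ℕ := ⌊2 * k * b⌋₊ with hM
  have hkb : 0 ≤ 2 * k * b := by positivity
  set good : Finset (Fin k → Fin p) := Finset.univ.filter fun i =>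
    ∀ t, |((i t : ℕ) : ℝ) - (i (finRotate k t) : ℕ)| ≤ b with hgood
  have hinj : Set.InjOn (word (k := k) (p := p)) good := by
    intro i _ i' _ h
    funext v
    have := congrFun h v
    simp only [word, add_left_inj, Nat.cast_inj] at this
    exact Fin.ext this
  have hX : ∀ j ∈ good.image word, ∃ x ∈ pinnedValues p M (representatives P) v₀,
      ∀ v ∈ representatives P, j v = x v := by
    intro j hj
    obtain ⟨i, hi, rfl⟩ := Finset.mem_image.1 hj
    refine exists_mem_pinnedValues hv₀ (fun v => ?_) fun v w => ?_
    · have := (i v).2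
      unfold word
      omega
    · have h1 := abs_sub_le_of_finRotate (fun t => ((i t : ℕ) : ℝ)) b
        (Finset.mem_filter.1 hi).2 v w
      have h2 : (((word i v - word i w).natAbs : ℕ) : ℝ) ≤ 2 * k * b := by
        rw [Nat.cast_natAbs]
        simp only [word, add_sub_add_right_eq_sub]
        push_cast
        exact h1
      rw [Int.abs_eq_natAbs]
      exact Int.ofNat_le.2 (Nat.le_floor h2)
  have hmain := sum_le_card_mul_of_pinned (fun j => ∏ A ∈ P.parts, G A j) (representatives P) KE hF
    (pinnedValues p M (representatives P) v₀) (good.image word) hX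
  have hlhs : ∑ i : Fin k → Fin p, bandProd b i *
      |cumulantProd μ Z P fun a => word i (letter a)| =
      ∑ j ∈ good.image word, |cumulantProd μ Z P fun a => j (letter a)| := by
    rw [Finset.sum_image hinj, hgood, Finset.sum_filter]
    refine Finset.sum_congr rfl fun i _ => ?_
    rw [bandProd_eq]
    split_ifs <;> simp
  have hcard : ((pinnedValues p M (representatives P) v₀).card : ℝ) ≤
      p * (2 * (2 * k * b) + 1) ^ (cardJoin (matching1 k) P - 1) := by
    have h1 := card_pinnedValues_le p M hv₀
    have h2 : (M : ℝ) ≤ 2 * k * b := Nat.floor_le hkb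
    have h3 : (2 * M + 1) ^ ((representatives P).card - 1) ≤
        (2 * M + 1) ^ (cardJoin (matching1 k) P - 1) :=
      Nat.pow_le_pow_right (by omega) (Nat.sub_le_sub_right (card_representatives_le P) 1)
    calc ((pinnedValues p M (representatives P) v₀).card : ℝ)
        ≤ ((p * (2 * M + 1) ^ (cardJoin (matching1 k) P - 1) : ℕ) : ℝ) := by
          exact_mod_cast h1.trans (Nat.mul_le_mul_left p h3)
      _ ≤ _ := by
          push_cast
          gcongr
  rw [hlhs]
  refine le_trans ?_ (mul_le_mul_of_nonneg_right hcard ENNReal.toReal_nonneg)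
  have hfin : ((pinnedValues p M (representatives P) v₀).card : ℝ≥0∞) * KE ≠ ∞ :=
    ENNReal.mul_ne_top (ENNReal.natCast_ne_top _) hKE_top
  have hto : ((pinnedValues p M (representatives P) v₀).card : ℝ) * KE.toReal =
      (((pinnedValues p M (representatives P) v₀).card : ℝ≥0∞) * KE).toReal := by
    rw [ENNReal.toReal_mul, ENNReal.toReal_natCast]
  rw [hto, ← ENNReal.ofReal_le_iff_le_toReal hfin,
    ENNReal.ofReal_sum_of_nonneg fun _ _ => abs_nonneg _]
  refine le_trans (le_of_eq (Finset.sum_congr rfl fun j _ => ?_)) hmain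
  rw [cumulantProd, Finset.abs_prod, ENNReal.ofReal_prod_of_nonneg fun _ _ => abs_nonneg _]

/-- Power counting: a partition other than `Π₀` contributes at most a constant times
`(b / n) ^ s * n ^ (-d)` with `s = #(Π₁ ∨ P) - 1` and `s + d = k - #(Π₀ ∨ P) > 0`. -/
theorem tendsto_contribution_zero (hZ : IsStationary μ Z) (hcum : CumulantSummable μ Z)
    (hk : 0 < k) {b : ℕ → ℝ} {n : ℕ → ℕ} (hbn : BandRegime b n) {P : Part k} (hP : P ∈ part2 k)
    (hne : P ≠ matching0 k) :
    Tendsto (fun p : ℕ => contribution μ Z (b p) (n p) p P) atTop (𝓝 0) := by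
  obtain ⟨K, hK0, hK⟩ := exists_sum_band_cumulant_le hZ hcum hk hP
  have hq := cardJoin_add_cardJoin_le hP hk
  have hq1 := cardJoin_pos (matching1 k) P hk
  have hq0 : cardJoin (matching0 k) P ≠ k := fun h => hne (eq_matching0_of_cardJoin_eq hP h)
  obtain ⟨s, hs⟩ : ∃ s, cardJoin (matching1 k) P = s + 1 := ⟨_, (Nat.sub_add_cancel hq1).symm⟩
  obtain ⟨d, hd⟩ : ∃ d, cardJoin (matching0 k) P + s + d = k :=
    ⟨k - (cardJoin (matching0 k) P + s), by omega⟩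
  have hsd : 0 < s + d := by omega
  have hinv : Tendsto (fun p => ((n p : ℝ))⁻¹) atTop (𝓝 0) :=
    tendsto_inv_atTop_zero.comp (tendsto_natCast_atTop_atTop.comp hbn.n_tendsto)
  have hlim : Tendsto (fun p => (4 * k + 1 : ℝ) ^ s * K *
      ((b p / n p) ^ s * ((n p : ℝ)⁻¹) ^ d)) atTop (𝓝 0) := by
    have h := ((hbn.ratio_tendsto.pow s).mul (hinv.pow d)).const_mul ((4 * k + 1 : ℝ) ^ s * K)
    rwa [← pow_add, zero_pow hsd.ne', mul_zero] at h
  refine squeeze_zero_norm' ?_ hlim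
  filter_upwards [eventually_ge_atTop 1, hbn.b_tendsto.eventually_ge_atTop 1] with p hp hb
  have hp' : (p : ℝ) ≠ 0 := by positivity
  have hn : 0 < n p := hbn.n_pos p hp
  have hn' : (n p : ℝ) ≠ 0 := by positivity
  have hexp : -(k : ℤ) + (cardJoin (matching0 k) P : ℤ) = -((s + d : ℕ) : ℤ) := by
    omega
  have hbase : (2 * (2 * k * b p) + 1) ≤ (4 * k + 1 : ℝ) * b p := by nlinarith
  have hsum : |∑ i : Fin k → Fin p, bandProd (b p) i *
      cumulantProd μ Z P fun a => word i (letter a)| ≤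
      p * ((4 * k + 1 : ℝ) * b p) ^ s * K := by
    refine (Finset.abs_sum_le_sum_abs _ _).trans ?_
    have h1 := hK (b p) p (by linarith)
    rw [hs, Nat.add_sub_cancel] at h1
    refine le_trans (le_of_eq (Finset.sum_congr rfl fun i _ => ?_)) (h1.trans ?_)
    · rw [abs_mul, abs_of_nonneg]
      rw [bandProd_eq]
      split_ifs <;> simp
    · have : 0 ≤ 2 * (2 * k * b p) + 1 := by positivity
      gcongr
  rw [contribution_eq, hexp, zpow_neg, zpow_natCast, Real.norm_eq_abs, abs_mul,
    abs_of_nonneg (by positivity : (0 : ℝ) ≤ (p : ℝ)⁻¹ * ((n p : ℝ) ^ (s + d))⁻¹)]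
  refine (mul_le_mul_of_nonneg_left hsum (by positivity)).trans_eq ?_
  rw [mul_pow, div_pow, inv_pow, pow_add]
  field_simp

end Contribution

/-! ### Expected traces -/

/-- The trace of a power of the matrix as a sum over cyclic words `i` of time indices and
assignments `r` of rows to the factors. -/
theorem trace_bandedCov_pow {Ω' : Type*} {W : ℕ → ℤ → Ω' → ℝ} {k : ℕ}
    (hk : 0 < k) (b : ℝ) (n p : ℕ) (ω : Ω') :
    ((bandedCov W b n p ω) ^ k).trace = ∑ i : Fin k → Fin p, ∑ r : Fin k → Fin n,
      bandProd b i * ((n : ℝ)⁻¹) ^ k * ∏ a : Pos k, W (r a.1) (word i (letter a)) ω := by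
  rw [trace_pow_eq_sum_cyclic _ hk]
  refine Finset.sum_congr rfl fun i _ => ?_
  have hentry : ∀ x y : Fin p, bandedCov W b n p ω x y = bandMatrix b p x y *
      ((n : ℝ)⁻¹ * ∑ r : Fin n, W r ((x : ℤ) + 1) ω * W r ((y : ℤ) + 1) ω) := by
    intro x y
    rw [bandedCov, Matrix.of_apply, Matrix.mul_apply]
    congr 1
    rw [Finset.mul_sum]
    refine Finset.sum_congr rfl fun r _ => ?_
    rw [Matrix.transpose_apply, dataMatrix, Matrix.of_apply, Matrix.of_apply, div_mul_div_comm,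
      Real.mul_self_sqrt (Nat.cast_nonneg n), div_eq_inv_mul]
  simp only [hentry]
  rw [Finset.prod_mul_distrib, Finset.prod_mul_distrib, Finset.prod_const, Finset.card_univ,
    Fintype.card_fin, Finset.prod_univ_sum, Fintype.piFinset_univ, Finset.mul_sum, Finset.mul_sum]
  refine Finset.sum_congr rfl fun r _ => ?_
  rw [← mul_assoc, bandProd, Fintype.prod_prod_type]
  congr 1
  refine Finset.prod_congr rfl fun t _ => ?_
  rw [Fintype.prod_bool, mul_comm]
  rfl

section Expectation

variable {Ω Ω' : Type*} [MeasurableSpace Ω] [MeasurableSpace Ω'] {μ : Measure Ω}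
  {μ' : Measure Ω'} {Z : ℤ → Ω → ℝ}
  {W : ℕ → ℤ → Ω' → ℝ}

theorem memLp_of_cumulantSummable (hZ : IsStationary μ Z) (hcum : CumulantSummable μ Z) (j : ℤ)
    {q : ℕ} (hq : q ≠ 0) : MemLp (Z j) q μ := by
  have h0 : MemLp (Z 0) q μ := by
    rw [← integrable_norm_rpow_iff (hZ.measurable 0).aestronglyMeasurable
      (by exact_mod_cast hq) (ENNReal.natCast_ne_top q)]
    simpa using hcum.moments q (Nat.one_le_iff_ne_zero.2 hq)
  have hid : IdentDistrib (Z 0) (Z j) μ μ := by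
    have h1 : IdentDistrib (fun ω (i : ℤ) => Z i ω) (fun ω (i : ℤ) => Z (i + j) ω) μ μ :=
      ⟨(measurable_pi_lambda _ fun i => hZ.measurable _).aemeasurable,
        (measurable_pi_lambda _ fun i => hZ.measurable _).aemeasurable, (hZ.map_shift j).symm⟩
    have h2 := h1.comp (measurable_pi_apply (0 : ℤ))
    simpa [Function.comp_def] using h2
  exact hid.memLp_iff.1 h0

theorem memLp_copy (hZ : IsStationary μ Z) (hcum : CumulantSummable μ Z)
    (hident : ∀ i : ℕ,
      IdentDistrib (fun (ω : Ω') (j : ℤ) => W i j ω) (fun (ω : Ω) (j : ℤ) => Z j ω) μ' μ)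
    (i : ℕ) (j : ℤ) {q : ℕ} (hq : q ≠ 0) : MemLp (W i j) q μ' :=
  ((hident i).comp (measurable_pi_apply j)).memLp_iff.2 (memLp_of_cumulantSummable hZ hcum j hq)

theorem integrable_prod_copy [IsProbabilityMeasure μ'] (hZ : IsStationary μ Z) (hcum : CumulantSummable μ Z)
    (hident : ∀ i : ℕ,
      IdentDistrib (fun (ω : Ω') (j : ℤ) => W i j ω) (fun (ω : Ω) (j : ℤ) => Z j ω) μ' μ)
    {ι : Type*} (s : Finset ι) (ρ : ι → ℕ) (j : ι → ℤ) :
    Integrable (fun ω => ∏ a ∈ s, W (ρ a) (j a) ω) μ' := by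
  rcases s.eq_empty_or_nonempty with rfl | hs
  · simp
  · have hc : s.card ≠ 0 := hs.card_pos.ne'
    have h := MemLp.prod' (s := s) (p := fun _ => (s.card : ℝ≥0∞)) (μ := μ')
      fun a _ => memLp_copy hZ hcum hident (ρ a) (j a) hc
    rw [Finset.sum_const, nsmul_eq_mul, ENNReal.mul_inv_cancel (by exact_mod_cast hc)
      (ENNReal.natCast_ne_top _), inv_one, memLp_one_iff_integrable] at h
    exact h

/-- Independence of the rows factorizes mixed moments. -/
theorem integral_prod_copy
    (hindep : iIndepFun (fun (i : ℕ) (ω : Ω') (j : ℤ) => W i j ω) μ')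
    (hident : ∀ i : ℕ,
      IdentDistrib (fun (ω : Ω') (j : ℤ) => W i j ω) (fun (ω : Ω) (j : ℤ) => Z j ω) μ' μ)
    {ι : Type*} [Fintype ι] {n : ℕ} (ρ : ι → Fin n) (j : ι → ℤ) :
    ∫ ω, ∏ a, W (ρ a) (j a) ω ∂μ' =
      ∏ s : Fin n, ∫ ω, ∏ a ∈ Finset.univ.filter (fun a => ρ a = s), Z (j a) ω ∂μ := by
  have hg : ∀ s : Fin n, Measurable fun z : ℤ → ℝ =>
      ∏ a ∈ Finset.univ.filter (fun a => ρ a = s), z (j a) := fun s =>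
    Finset.measurable_prod _ fun i _ => measurable_pi_apply _
  have h1 := (hindep.precomp (Fin.val_injective (n := n))).integral_fun_prod_comp
    (fun s => (hident s).aemeasurable_fst) (fun s => (hg s).aestronglyMeasurable)
  have h2 : ∀ ω, ∏ a, W (ρ a) (j a) ω =
      ∏ s : Fin n, ∏ a ∈ Finset.univ.filter (fun a => ρ a = s), W s (j a) ω := by
    intro ω
    rw [← Finset.prod_fiberwise (Finset.univ : Finset ι) ρ]
    refine Finset.prod_congr rfl fun s _ => Finset.prod_congr rfl fun a ha => ?_
    rw [(Finset.mem_filter.1 ha).2]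
  simp only [h2]
  rw [h1]
  exact Finset.prod_congr rfl fun s _ => ((hident s).comp (hg s)).integral_eq

/-- The moment-cumulant formula for independent groups of variables: only the partitions whose
blocks lie within the groups contribute. -/
theorem prod_moment_eq_sum_cumulant {ι : Type*} [DecidableEq ι] {n : ℕ} (ρ : ι → Fin n)
    (m : Finset ι → ℝ) (h0 : m ∅ = 1) (S : Finset ι) :
    ∏ s : Fin n, m (S.filter fun a => ρ a = s) = ∑ P : Finpartition S, ∏ A ∈ P.parts,
      if ∀ a ∈ A, ∀ a' ∈ A, ρ a = ρ a' then cumulantOf m A else 0 := by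
  refine eq_sum_finpartition_of_recursion
    (fun S => ∏ s : Fin n, m (S.filter fun a => ρ a = s)) _ (by simp [h0]) (fun S a ha => ?_) S
  have hsplit : ∀ S : Finset ι, ∏ s : Fin n, m (S.filter fun x => ρ x = s) =
      m (S.filter fun x => ρ x = ρ a) *
        ∏ s ∈ Finset.univ.erase (ρ a), m (S.filter fun x => ρ x = s) :=
    fun S => (Finset.mul_prod_erase _ _ (Finset.mem_univ (ρ a))).symm
  have ha' : a ∈ S.filter fun x => ρ x = ρ a := Finset.mem_filter.2 ⟨ha, rfl⟩
  rw [hsplit, moment_eq_sum_cumulantOf m h0 ha', Finset.sum_mul]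
  have hsub : (S.filter fun x => ρ x = ρ a).powerset.filter (a ∈ ·) ⊆
      S.powerset.filter (a ∈ ·) := fun A hA => by
    simp only [Finset.mem_filter, Finset.mem_powerset] at hA ⊢
    exact ⟨hA.1.trans (Finset.filter_subset _ _), hA.2⟩
  rw [← Finset.sum_subset hsub]
  · refine Finset.sum_congr rfl fun A hA => ?_
    simp only [Finset.mem_filter, Finset.mem_powerset] at hA
    have hA2 : ∀ x ∈ A, ρ x = ρ a := fun x hx => (Finset.mem_filter.1 (hA.1 hx)).2
    rw [if_pos fun x hx y hy => (hA2 x hx).trans (hA2 y hy).symm, hsplit, mul_assoc]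
    have e1 : (S \ A).filter (fun x => ρ x = ρ a) = (S.filter fun x => ρ x = ρ a) \ A := by
      ext x
      simp only [Finset.mem_filter, Finset.mem_sdiff]
      tauto
    have e2 : ∏ s ∈ Finset.univ.erase (ρ a), m ((S \ A).filter fun x => ρ x = s) =
        ∏ s ∈ Finset.univ.erase (ρ a), m (S.filter fun x => ρ x = s) := by
      refine Finset.prod_congr rfl fun s hs => ?_
      congr 1
      ext x
      simp only [Finset.mem_filter, Finset.mem_sdiff]
      refine ⟨fun h => ⟨h.1.1, h.2⟩, fun h => ⟨⟨h.1, fun hxA => ?_⟩, h.2⟩⟩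
      exact Finset.ne_of_mem_erase hs (h.2.symm.trans (hA2 x hxA))
    rw [e1, e2]
  · intro A hA hA'
    simp only [Finset.mem_filter, Finset.mem_powerset] at hA hA'
    rw [if_neg, zero_mul]
    exact fun h => hA' ⟨fun x hx => Finset.mem_filter.2 ⟨hA.1 hx, h x hx a hA.2⟩, hA.2⟩

theorem integral_prod_copy_eq_sum [IsProbabilityMeasure μ] {k : ℕ}
    (hindep : iIndepFun (fun (i : ℕ) (ω : Ω') (j : ℤ) => W i j ω) μ')
    (hident : ∀ i : ℕ,
      IdentDistrib (fun (ω : Ω') (j : ℤ) => W i j ω) (fun (ω : Ω) (j : ℤ) => Z j ω) μ' μ)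
    {n : ℕ} (ρ : Pos k → Fin n) (j : Pos k → ℤ) [∀ P : Part k, Decidable (IsMeas P ρ)] :
    ∫ ω, ∏ a, W (ρ a) (j a) ω ∂μ' =
      ∑ P : Part k, if IsMeas P ρ then cumulantProd μ Z P j else 0 := by
  rw [integral_prod_copy hindep hident, prod_moment_eq_sum_cumulant ρ
    (fun A => ∫ ω, ∏ a ∈ A, Z (j a) ω ∂μ) (by simp)]
  refine Finset.sum_congr rfl fun P _ => ?_
  by_cases hP : IsMeas P ρ
  · rw [if_pos hP]
    exact Finset.prod_congr rfl fun A hA => if_pos (hP A hA)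
  · rw [if_neg hP]
    obtain ⟨A, hA⟩ := not_forall.1 hP
    obtain ⟨hA, hne⟩ := Classical.not_imp.1 hA
    exact Finset.prod_eq_zero hA (if_neg hne)

/-- Counting the row assignments compatible with a partition. -/
theorem card_isMeas_fst {k n : ℕ} (P : Part k)
    [DecidablePred fun r : Fin k → Fin n => IsMeas P fun a => r a.1] :
    (Finset.univ.filter fun r : Fin k → Fin n => IsMeas P fun a => r a.1).card =
      n ^ cardJoin (matching0 k) P := by
  classical
  have h : Function.Bijective fun (g : Quotient (joinSetoid (matching0 k) P) → Fin n) =>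
      (⟨fun t => g (Quotient.mk _ (t, false)), by
        have h1 := ((joinSetoid_le_ker_iff (matching0 k) P
          (fun a => g (Quotient.mk _ a))).1 fun a a' h => congrArg g (Quotient.sound h)).2
        have h2 : (fun a : Pos k => g (Quotient.mk _ (a.1, false))) =
            fun a => g (Quotient.mk _ a) := funext fun a =>
          congrArg g (mk_eq_of_left ((matching0_part_eq_iff _ _).2 rfl))
        rw [h2]
        exact h1⟩ : {r : Fin k → Fin n // IsMeas P fun a => r a.1}) := by
    constructor
    · intro g g' hgg'
      funext q
      obtain ⟨t, rfl⟩ := surjective_mk_false P q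
      exact congrFun (congrArg Subtype.val hgg') t
    · rintro ⟨r, hr⟩
      have hle := (joinSetoid_le_ker_iff (matching0 k) P (fun a => r a.1)).2
        ⟨(isMeas_matching0_iff _).2 ⟨r, rfl⟩, hr⟩
      exact ⟨Quotient.lift (fun a => r a.1) fun a a' h => hle h, rfl⟩
  rw [cardJoin_eq, ← Fintype.card_subtype, ← Nat.card_eq_fintype_card, ← Nat.card_eq_of_bijective _ h,
    Nat.card_fun, Nat.card_eq_fintype_card, Fintype.card_fin]

theorem integrable_trace_bandedCov_pow [IsProbabilityMeasure μ'] (hZ : IsStationary μ Z) (hcum : CumulantSummable μ Z)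
    (hident : ∀ i : ℕ,
      IdentDistrib (fun (ω : Ω') (j : ℤ) => W i j ω) (fun (ω : Ω) (j : ℤ) => Z j ω) μ' μ)
    {k : ℕ} (hk : 0 < k) (b : ℝ) (n p : ℕ) :
    Integrable (fun ω => ((bandedCov W b n p ω) ^ k).trace) μ' := by
  simp only [trace_bandedCov_pow hk]
  exact integrable_finsetSum _ fun i _ => integrable_finsetSum _ fun r _ =>
    (integrable_prod_copy hZ hcum hident Finset.univ (fun a : Pos k => (r a.1 : ℕ))
      fun a => word i (letter a)).const_mul _

theorem expected_trace_eq_sum_contribution [IsProbabilityMeasure μ]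
    [IsProbabilityMeasure μ'] (hZ : IsStationary μ Z) (hcum : CumulantSummable μ Z)
    (hindep : iIndepFun (fun (i : ℕ) (ω : Ω') (j : ℤ) => W i j ω) μ')
    (hident : ∀ i : ℕ,
      IdentDistrib (fun (ω : Ω') (j : ℤ) => W i j ω) (fun (ω : Ω) (j : ℤ) => Z j ω) μ' μ)
    {k : ℕ} (hk : 0 < k) (b : ℝ) {n : ℕ} (hn : 0 < n) (p : ℕ) :
    (p : ℝ)⁻¹ * ∫ ω, ((bandedCov W b n p ω) ^ k).trace ∂μ' =
      ∑ P ∈ part2 k, contribution μ Z b n p P := by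
  classical
  have hint : ∀ (i : Fin k → Fin p) (r : Fin k → Fin n), Integrable (fun ω =>
      bandProd b i * ((n : ℝ)⁻¹) ^ k * ∏ a : Pos k, W (r a.1) (word i (letter a)) ω) μ' :=
    fun i r => (integrable_prod_copy hZ hcum hident Finset.univ (fun a : Pos k => (r a.1 : ℕ))
      fun a => word i (letter a)).const_mul _
  have hsub : ∑ P ∈ part2 k, contribution μ Z b n p P = ∑ P : Part k, contribution μ Z b n p P := by
    refine Finset.sum_subset (Finset.subset_univ _) fun P _ hP => ?_
    rw [contribution_eq, Finset.sum_eq_zero, mul_zero]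
    intro i _
    rw [cumulantProd_eq_zero hZ hcum hP, mul_zero]
  have hrow : ∀ i : Fin k → Fin p, ∑ r : Fin k → Fin n,
      ∫ ω, ∏ a : Pos k, W (r a.1) (word i (letter a)) ω ∂μ' =
      ∑ P : Part k, (n : ℝ) ^ cardJoin (matching0 k) P *
        cumulantProd μ Z P fun a => word i (letter a) := by
    intro i
    have h1 : ∀ r : Fin k → Fin n, ∫ ω, ∏ a : Pos k, W (r a.1) (word i (letter a)) ω ∂μ' =
        ∑ P : Part k, if IsMeas P (fun a => r a.1) then
          cumulantProd μ Z P (fun a => word i (letter a)) else 0 := fun r =>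
      integral_prod_copy_eq_sum hindep hident (fun a : Pos k => r a.1) _
    simp only [h1]
    rw [Finset.sum_comm]
    refine Finset.sum_congr rfl fun P _ => ?_
    rw [← Finset.sum_filter, Finset.sum_const, card_isMeas_fst, nsmul_eq_mul, Nat.cast_pow]
  simp only [trace_bandedCov_pow hk]
  rw [integral_finsetSum _ fun i _ => integrable_finsetSum _ fun r _ => hint i r, hsub,
    Finset.sum_congr rfl fun P _ => contribution_eq b n p P]
  have hn' : (n : ℝ) ≠ 0 := by positivity
  have hpow : ∀ P : Part k, (p : ℝ)⁻¹ *
      (n : ℝ) ^ (-(k : ℤ) + (cardJoin (matching0 k) P : ℤ)) =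
      (p : ℝ)⁻¹ * (((n : ℝ)⁻¹) ^ k * (n : ℝ) ^ cardJoin (matching0 k) P) := by
    intro P
    rw [zpow_add₀ hn', zpow_neg, zpow_natCast, zpow_natCast, inv_pow]
  simp only [hpow, Finset.mul_sum]
  rw [Finset.sum_comm]
  refine Finset.sum_congr rfl fun i _ => ?_
  rw [integral_finsetSum _ fun r _ => hint i r]
  simp only [integral_const_mul]
  rw [← Finset.mul_sum, hrow, Finset.mul_sum, Finset.mul_sum]
  refine Finset.sum_congr rfl fun P _ => ?_
  ring

end Expectation

end BandedCov

open BandedCov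
theorem proposition7p1
    {Ω Ω' : Type*} [MeasurableSpace Ω] [MeasurableSpace Ω']
    (μ : Measure Ω) [IsProbabilityMeasure μ] (μ' : Measure Ω') [IsProbabilityMeasure μ']
    (Z : ℤ → Ω → ℝ) (hZ : IsStationary μ Z) (hcum : CumulantSummable μ Z)
    (W : ℕ → ℤ → Ω' → ℝ)
    (hindep : iIndepFun (fun (i : ℕ) (ω : Ω') (j : ℤ) => W i j ω) μ')
    (hident : ∀ i : ℕ,
      IdentDistrib (fun (ω : Ω') (j : ℤ) => W i j ω) (fun (ω : Ω) (j : ℤ) => Z j ω) μ' μ)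
    (b : ℕ → ℝ) (n : ℕ → ℕ) (hbn : BandRegime b n) :
    -- the covariances, their convolution powers and the spectral density are well defined
    Summable (autocov μ Z) ∧
    (∀ (m : ℕ) (i : ℤ), Summable fun l : ℤ => convPow (autocov μ Z) m (i - l) * autocov μ Z l) ∧
    (∀ θ : ℝ, HasSum
      (fun j : ℤ => Complex.exp (2 * Real.pi * Complex.I * j * θ) * (autocov μ Z j : ℂ))
      (specDensity (autocov μ Z) θ : ℂ)) ∧
    ∀ k : ℕ, 0 < k →
      (∀ p : ℕ, Integrable (fun ω => ((bandedCov W (b p) (n p) p ω) ^ k).trace) μ') ∧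
      -- convergence of the normalized expected traces
      Tendsto (fun p : ℕ => (p : ℝ)⁻¹ * ∫ ω, ((bandedCov W (b p) (n p) p ω) ^ k).trace ∂μ')
        atTop (𝓝 (convPow (autocov μ Z) k 0)) ∧
      -- the limit is the integral of the `k`-th power of the spectral density
      IntervalIntegrable (fun θ => specDensity (autocov μ Z) θ ^ k) volume 0 1 ∧
      convPow (autocov μ Z) k 0 = ∫ θ in (0 : ℝ)..1, specDensity (autocov μ Z) θ ^ k ∧
      -- only one partition contributes in the limit
      (∀ p : ℕ, 1 ≤ p →
        (p : ℝ)⁻¹ * ∫ ω, ((bandedCov W (b p) (n p) p ω) ^ k).trace ∂μ' =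
          ∑ P ∈ part2 k, contribution μ Z (b p) (n p) p P) ∧
      (∀ P ∈ part2 k, P ≠ matching0 k →
        Tendsto (fun p : ℕ => contribution μ Z (b p) (n p) p P) atTop (𝓝 0)) ∧
      Tendsto (fun p : ℕ => contribution μ Z (b p) (n p) p (matching0 k))
        atTop (𝓝 (convPow (autocov μ Z) k 0)) := by
  have hR := summable_autocov hZ hcum
  have heven := autocov_neg hZ hcum
  refine ⟨hR, summable_convPow_mul hR, hasSum_specDensity hR heven, fun k hk => ?_⟩
  have hexp : ∀ p : ℕ, 1 ≤ p →
      (p : ℝ)⁻¹ * ∫ ω, ((bandedCov W (b p) (n p) p ω) ^ k).trace ∂μ' =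
        ∑ P ∈ part2 k, contribution μ Z (b p) (n p) p P := fun p hp =>
    expected_trace_eq_sum_contribution hZ hcum hindep hident hk (b p) (hbn.n_pos p hp) p
  have hzero : ∀ P ∈ part2 k, P ≠ matching0 k →
      Tendsto (fun p : ℕ => contribution μ Z (b p) (n p) p P) atTop (𝓝 0) := fun P hP hne =>
    tendsto_contribution_zero hZ hcum hk hbn hP hne
  have hmain : Tendsto (fun p : ℕ => contribution μ Z (b p) (n p) p (matching0 k))
      atTop (𝓝 (convPow (autocov μ Z) k 0)) := by
    simp only [contribution_matching0 hZ hcum hk]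
    exact tendsto_trace_toeplitz_pow hR hbn.b_tendsto k
  refine ⟨fun p => integrable_trace_bandedCov_pow hZ hcum hident hk (b p) (n p) p, ?_,
    ((continuous_specDensity hR).pow k).intervalIntegrable 0 1,
    (integral_specDensity_pow hR heven k).symm, hexp, hzero, hmain⟩
  have hsum : Tendsto (fun p : ℕ => ∑ P ∈ part2 k, contribution μ Z (b p) (n p) p P) atTop
      (𝓝 (∑ P ∈ part2 k, if P = matching0 k then convPow (autocov μ Z) k 0 else 0)) := by
    refine tendsto_finsetSum _ fun P hP => ?_
    split_ifs with h
    · rw [h]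
      exact hmain
    · exact hzero P hP h
  rw [Finset.sum_ite_eq' _ _ fun _ => _, if_pos matching0_mem_part2] at hsum
  refine hsum.congr' ?_
  filter_upwards [eventually_ge_atTop 1] with p hp
  exact (hexp p hp).symm
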